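/- Let $G$ be a locally elliptic group, i.e. a locally compact (Hausdorff) group in which every compact subset generates a relatively compact subgroup, with a fixed Haar measure. Let $\Phi:\mathbb{R}\to[0,\infty]$ be a Young function (convex, even, $\Phi(0)=0$, $\lim_{x\to\infty}\Phi(x)=\infty$) whose complementary function $\Psi(y)=\sup\{x|y|-\Phi(x):x\ge 0\}$ is also a Young function. Let $L^\Phi(G)$ be the Orlicz space of measurable $f:G\to\mathbb{C}$ (modulo equality almost everywhere) with $\int_G\Phi(\alpha|f|)\,dx<\infty$ for some $\alpha>0$, equipped with the Orlicz norm $\|f\|_{L^\Phi(G)}=\sup\{\int_G|fg|\,dx:\int_G\Psi(|g|)\,dx\le 1\}$; $L^\Psi(G)$ is defined in the same way. Let $\omega:G\to[1,\infty)$ be a weight, i.e. a measurable function that is bounded on compact sets and satisfies $\omega(xy)\le\omega(x)\omega(y)$ and $\omega(x^{-1})=\omega(x)$ for all $x,y\in G$, and let $L^\Phi(G,\omega)=\{f\in L^\Phi(G):\|f\omega\|_{L^\Phi(G)}<\infty\}$ with the norm $\|f\|_{L^\Phi(G,\omega)}=\|f\omega\|_{L^\Phi(G)}$. Assume that $\omega$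 is an $L^\Phi$-weight, i.e. that $L^\Phi(G,\omega)$ is a Banach $*$-algebra (with a norm that is submultiplicative up to a constant) under convolution and the involution $f^*(x)=\overline{f(x^{-1})}$, and that $1/\omega\in L^\Psi(G)$. For a convolution algebra $\mathcal{A}$ write $\sigma_{\mathcal{A}}(f)$ for the spectrum of $f\in\mathcal{A}$, computed in the unitization if $\mathcal{A}$ has no identity; call $\mathcal{A}$ Hermitian if every $f=f^*$ in $\mathcal{A}$ has $\sigma_{\mathcal{A}}(f)\subseteq\mathbb{R}$, and call $G$ Hermitian if $L^1(G)$ is. Then the following hold. (i) $L^\Phi(G,\omega)$ is quasi-Hermitian: $C_c(G)\subseteq L^\Phi(G,\omega)$, and every $f=f^*\in C_c(G)$ satisfies $\sigma_{L^\Phi(G,\omega)}(f)\subseteq\mathbb{R}$. (ii) If $G$ is Hermitian and $\omega$ is sub-additive, i.e. there is a constant $C>0$ with $\omega(xy)\le C(\omega(x)+\omega(y))$ for all $x,y\in G$, then $L^\Phi(G,\omega)\subseteq L^1(G)$ and $\sigma_{L^\Phi(G,\omega)}(f)=\sigma_{L^1(G)}(f)$ for all $f\in L^\Phi(G,\omega)$.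 In particular, $L^\Phi(G,\omega)$ is Hermitian. -/

import Mathlib

open MeasureTheory Filter Topology
open scoped ENNReal NNReal

/-! ### Locally elliptic groups -/

/-- A topological group is locally elliptic if every compact subset generates a
relatively compact subgroup. -/
def IsLocallyElliptic (G : Type*) [Group G] [TopologicalSpace G] : Prop :=
  ∀ K : Set G, IsCompact K → IsCompact (closure (Subgroup.closure K : Set G))

/-! ### Young functions and Orlicz spaces -/

/-- A Young function: a convex even function `Φ : ℝ → [0, ∞]` with `Φ 0 = 0` and
`Φ x → ∞` as `x → ∞`. -/
structure IsYoungFunction (Φ : ℝ → ℝ≥0∞) : Prop where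
  convex : ConvexOn ℝ≥0 Set.univ Φ
  even : ∀ x, Φ (-x) = Φ x
  zero : Φ 0 = 0
  tendsto : Tendsto Φ atTop (𝓝 ∞)

/-- The complementary function `y ↦ sup {x |y| - Φ x : x ≥ 0}`. The subtraction is truncated at
`0`, which does not change the supremum, because `x = 0` contributes the value `0`
when `Φ 0 = 0`. -/
noncomputable def complementaryFunction (Φ : ℝ → ℝ≥0∞) (y : ℝ) : ℝ≥0∞ :=
  ⨆ x : ℝ≥0, (ENNReal.ofReal ((x : ℝ) * |y|) - Φ (x : ℝ))

/-- `(Φ, Ψ)` is a complementary pair of Young functions. -/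
structure IsComplementaryPair (Φ Ψ : ℝ → ℝ≥0∞) : Prop where
  left : IsYoungFunction Φ
  right : IsYoungFunction Ψ
  eq_complementary : Ψ = complementaryFunction Φ

section Orlicz

variable {G : Type*} [MeasurableSpace G]

/-- Membership in the Orlicz space `L^Φ`: `f` is measurable and `∫ Φ (α |f|) < ∞` for some
`α > 0`. -/
def MemOrlicz {E : Type*} [NormedAddCommGroup E] (Φ : ℝ → ℝ≥0∞) (μ : Measure G) (f : G → E) :
    Prop :=
  AEStronglyMeasurable f μ ∧ ∃ α : ℝ, 0 < α ∧ ∫⁻ x, Φ (α * ‖f x‖) ∂μ < ∞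

/-- The Orlicz norm on `L^Φ`, as a function of the complementary Young function `Ψ`:
`‖f‖ = sup {∫ |f g| : ∫ Ψ (|g|) ≤ 1}`. -/
noncomputable def orliczNorm (Ψ : ℝ → ℝ≥0∞) (μ : Measure G) (f : G → ℂ) : ℝ≥0∞ :=
  ⨆ (g : G → ℂ) (_ : AEStronglyMeasurable g μ) (_ : ∫⁻ x, Ψ ‖g x‖ ∂μ ≤ 1),
    ∫⁻ x, ‖f x * g x‖ₑ ∂μ

/-- The weighted Orlicz norm `‖f ω‖` on `L^Φ(G, ω)`. -/
noncomputable def weightedOrliczNorm (Ψ : ℝ → ℝ≥0∞) (ω : G → ℝ) (μ : Measure G) (f : G → ℂ) :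
    ℝ≥0∞ :=
  orliczNorm Ψ μ (fun x => f x * (ω x : ℂ))

/-- The weighted Orlicz space `L^Φ(G, ω)`, as a set of functions; functions that agree almost
everywhere represent the same element. -/
def weightedOrliczSpace (Φ Ψ : ℝ → ℝ≥0∞) (ω : G → ℝ) (μ : Measure G) : Set (G → ℂ) :=
  {f | MemOrlicz Φ μ f ∧ weightedOrliczNorm Ψ ω μ f < ∞}

/-- The space `L^1(G)`, as a set of functions; functions that agree almost everywhere represent
the same element. -/
def integrableFunctions (μ : Measure G) : Set (G → ℂ) :=
  {f | Integrable f μ}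

end Orlicz

/-! ### Convolution, involution, spectrum -/

section Convolution

variable {G : Type*} [Group G] [MeasurableSpace G]

/-- The convolution `(f * g)(x) = ∫ f(y) g(y⁻¹ x) dy`. -/
noncomputable def groupConv (μ : Measure G) (f g : G → ℂ) : G → ℂ :=
  fun x => ∫ y, f y * g (y⁻¹ * x) ∂μ

/-- The involution `f^*(x) = conj (f(x⁻¹))`. -/
noncomputable def groupStar (f : G → ℂ) : G → ℂ :=
  fun x => (starRingEnd ℂ) (f x⁻¹)

/-- `e` represents the identity element of the convolution algebra `A`. -/
def IsConvIdentity (μ : Measure G) (A : Set (G → ℂ)) (e : G → ℂ) : Prop :=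
  e ∈ A ∧ ∀ f ∈ A, groupConv μ e f =ᵐ[μ] f ∧ groupConv μ f e =ᵐ[μ] f

/-- The product `(c + f)(d + g) = c d + (c g + d f + f * g)` of the unitization `ℂ ⊕ A` of a
convolution algebra `A`; the pair `(c, f)` stands for `c 1 + f`. -/
noncomputable def unitizationMul (μ : Measure G) (p q : ℂ × (G → ℂ)) : ℂ × (G → ℂ) :=
  (p.1 * q.1, p.1 • q.2 + q.1 • p.2 + groupConv μ p.2 q.2)

/-- `p` represents the identity element `(1, 0)` of the unitization. -/
def IsUnitizationOne (μ : Measure G) (p : ℂ × (G → ℂ)) : Prop :=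
  p.1 = 1 ∧ p.2 =ᵐ[μ] 0

/-- `f - z 1` is invertible: in `A` itself if `A` has an identity element, and in the unitization
`ℂ ⊕ A` if it has none. -/
def IsConvInvertible (μ : Measure G) (A : Set (G → ℂ)) (f : G → ℂ) (z : ℂ) : Prop :=
  (∃ e, IsConvIdentity μ A e ∧
    ∃ g ∈ A, groupConv μ (f - z • e) g =ᵐ[μ] e ∧ groupConv μ g (f - z • e) =ᵐ[μ] e) ∨
  ((¬ ∃ e, IsConvIdentity μ A e) ∧
    ∃ c : ℂ, ∃ g ∈ A, IsUnitizationOne μ (unitizationMul μ (-z, f) (c, g)) ∧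
      IsUnitizationOne μ (unitizationMul μ (c, g) (-z, f)))

/-- The spectrum of `f` in the convolution algebra `A` (computed in the unitization if `A` has
no identity element). -/
def convSpectrum (μ : Measure G) (A : Set (G → ℂ)) (f : G → ℂ) : Set ℂ :=
  {z | ¬ IsConvInvertible μ A f z}

/-- The convolution `*`-algebra `A` is Hermitian: self-adjoint elements have real spectrum. -/
def IsHermitianAlgebra (μ : Measure G) (A : Set (G → ℂ)) : Prop :=
  ∀ f ∈ A, groupStar f =ᵐ[μ] f → convSpectrum μ A f ⊆ Set.range ((↑) : ℝ → ℂ)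

/-- The convolution `*`-algebra `A` is quasi-Hermitian: its self-adjoint elements that lie in
`C_c(G)` have real spectrum in `A`. -/
def IsQuasiHermitianAlgebra [TopologicalSpace G] (μ : Measure G) (A : Set (G → ℂ)) : Prop :=
  ∀ f ∈ A, Continuous f → HasCompactSupport f → groupStar f =ᵐ[μ] f →
    convSpectrum μ A f ⊆ Set.range ((↑) : ℝ → ℂ)

/-- The group is Hermitian: `L^1(G)` is a Hermitian `*`-algebra. -/
def IsHermitianGroup (μ : Measure G) : Prop :=
  IsHermitianAlgebra μ (integrableFunctions μ)

end Convolution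

/-! ### Weights -/

section Weight

variable {G : Type*} [Group G] [TopologicalSpace G] [MeasurableSpace G]

/-- A weight: a measurable function `ω : G → [1, ∞)` that is bounded on compact sets,
sub-multiplicative and symmetric. -/
structure IsWeight (ω : G → ℝ) : Prop where
  measurable : Measurable ω
  one_le : ∀ x, 1 ≤ ω x
  bounded_on_compact : ∀ K : Set G, IsCompact K → BddAbove (ω '' K)
  submultiplicative : ∀ x y, ω (x * y) ≤ ω x * ω y
  symmetric : ∀ x, ω x⁻¹ = ω x

/-- Sub-additivity of a weight: `ω(xy) ≤ C (ω(x) + ω(y))` for some constant `C > 0`. -/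
def IsSubadditiveWeight (ω : G → ℝ) : Prop :=
  ∃ C : ℝ, 0 < C ∧ ∀ x y, ω (x * y) ≤ C * (ω x + ω y)

/-- `ω` is an `L^Φ`-weight: a weight for which `L^Φ(G, ω)` is a Banach `*`-algebra under
convolution and the involution `f^*(x) = conj (f(x⁻¹))`. As usual for Orlicz algebras, the norm is
submultiplicative up to a constant, which can be absorbed into the norm. Completeness,
bilinearity, associativity and the rules for the involution hold automatically and are not
part of the definition. -/
structure IsLPhiWeight (Φ Ψ : ℝ → ℝ≥0∞) (ω : G → ℝ) (μ : Measure G) : Prop where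
  weight : IsWeight ω
  conv_exists : ∀ f ∈ weightedOrliczSpace Φ Ψ ω μ, ∀ g ∈ weightedOrliczSpace Φ Ψ ω μ,
    ∀ᵐ x ∂μ, Integrable (fun y => f y * g (y⁻¹ * x)) μ
  conv_mem : ∀ f ∈ weightedOrliczSpace Φ Ψ ω μ, ∀ g ∈ weightedOrliczSpace Φ Ψ ω μ,
    groupConv μ f g ∈ weightedOrliczSpace Φ Ψ ω μ
  conv_norm_le : ∃ C : ℝ≥0, ∀ f ∈ weightedOrliczSpace Φ Ψ ω μ,
    ∀ g ∈ weightedOrliczSpace Φ Ψ ω μ,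
      weightedOrliczNorm Ψ ω μ (groupConv μ f g) ≤
        C * weightedOrliczNorm Ψ ω μ f * weightedOrliczNorm Ψ ω μ g
  star_mem : ∀ f ∈ weightedOrliczSpace Φ Ψ ω μ, groupStar f ∈ weightedOrliczSpace Φ Ψ ω μ
  star_norm : ∀ f ∈ weightedOrliczSpace Φ Ψ ω μ,
    weightedOrliczNorm Ψ ω μ (groupStar f) = weightedOrliczNorm Ψ ω μ f

end Weight

/-! Local ellipticity places every compact set inside a compact open subgroup. Since regular
left-invariant measures agree as soon as they agree on one such subgroup, the Haar measure is
invariant under right translations and inversion. The cosets of a compact open subgroup also make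
`G` normal, which supplies cut-offs and approximation by `C_c` functions. A scaled copy of `1/ω` is
a test function for the Orlicz norm, so `L^Φ(G, ω) ⊆ L¹(G)` and all algebra can be done in `L¹`.

Part (i): let `f = f^*` in `C_c(G)` be supported in a compact subgroup `H`. Convolution by `f` is a
self-adjoint operator on the Hilbert space `L²(H)`, so a non-real `z` lies in its resolvent set.
Solving the resolvent equation there gives an `L²` function; substituting it once into the equation
shows that it agrees almost everywhere with a bounded function `g` that vanishes off `H`. Such
functions lie in `L^Φ(G, ω)`, because `ω` is bounded on `H`, and `-z⁻¹ + g` inverts `f - z`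
(`exists_bounded_resolvent`).

Part (ii) is inverse-closedness of `L^Φ(G, ω)` in `L¹(G)`: if `(1 - a)(1 - b) = 1 = (1 - b)(1 - a)`
with `a ∈ L^Φ(G, ω)` and `b ∈ L¹`, then `b ∈ L^Φ(G, ω)` (`IsLPhiWeight.mem_of_quasiInverse`).
Approximate `b` in `L¹` by `p ∈ C_c(G)` and put `1 - u = (1 - a)(1 - p)`. Then `u ∈ L^Φ(G, ω)` has
small `L¹` norm, and `b = (p - u) + b * u`. Sub-additivity of `ω` gives the Leibniz inequality `‖b *
u‖ ≤ C (‖b‖ ‖u‖₁ + ‖b‖₁ ‖u‖)`, so for `C ‖u‖₁ ≤ 1/2` the term containing `‖b‖` can be absorbed.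
Absorption requires `‖b‖ < ∞`, which is the claim itself. It is therefore carried out for truncated
norms, which are finite on `L¹` (`truncatedNorm_groupConv_le`), with a bound independent of the
truncation. Equality of spectra follows, and with it the Hermitian property.

No countability is assumed of `G`, so multiplication need not be measurable for the product
`σ`-algebra. Fubini's theorem for convolutions is obtained by passing to representatives that are
limits of `C_c` functions and live on `σ`-compact sets. -/

/-! ### Compact open subgroups, normality and unimodularity -/

section Group

variable {G : Type*} [Group G] [TopologicalSpace G] [IsTopologicalGroup G]

/-- In a locally elliptic group, every compact set is contained in a compact open subgroup. -/
lemma IsLocallyElliptic.exists_isCompact_isOpen_subgroup [LocallyCompactSpace G]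
    (hG : IsLocallyElliptic G) {K : Set G} (hK : IsCompact K) :
    ∃ H : Subgroup G, IsOpen (H : Set G) ∧ IsCompact (H : Set G) ∧ K ⊆ H := by
  obtain ⟨L, hL, hL1⟩ := exists_compact_mem_nhds (1 : G)
  have hopen : IsOpen (Subgroup.closure (K ∪ L) : Set G) :=
    Subgroup.isOpen_of_mem_nhds _ (g := 1)
      (mem_of_superset hL1 (Set.subset_union_right.trans Subgroup.subset_closure))
  refine ⟨Subgroup.closure (K ∪ L), hopen, ?_, Set.subset_union_left.trans Subgroup.subset_closure⟩
  have := hG _ (hK.union hL)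
  rwa [(Subgroup.isClosed_of_isOpen _ hopen).closure_eq] at this

/-- A Hausdorff locally elliptic group is normal, being a disjoint union of compact open cosets. -/
lemma IsLocallyElliptic.normalSpace [LocallyCompactSpace G] [T2Space G]
    (hG : IsLocallyElliptic G) : NormalSpace G := by
  obtain ⟨H, hHo, hHc, -⟩ := hG.exists_isCompact_isOpen_subgroup (isCompact_empty (X := G))
  let c : G ⧸ H → Set G := fun q => {x | (x : G ⧸ H) = q}
  have hc : ∀ x : G, c x = (fun y => x⁻¹ * y) ⁻¹' H := fun x => by
    ext y
    simp only [c, Set.mem_ofPred_eq, Set.mem_preimage, SetLike.mem_coe]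
    rw [eq_comm, QuotientGroup.eq]
  have hco : ∀ q, IsOpen (c q) := fun q => by
    induction q using QuotientGroup.induction_on with
    | H x => exact hc x ▸ hHo.preimage (continuous_const_mul _)
  have hcc : ∀ q, IsCompact (c q) := fun q => by
    induction q using QuotientGroup.induction_on with
    | H x => exact hc x ▸ (Homeomorph.mulLeft x⁻¹).isCompact_preimage.2 hHc
  refine ⟨fun C D hC hD hCD => ?_⟩
  -- Inside one compact coset disjoint closed sets are separated. As the cosets are open and
  -- pairwise disjoint, these separations glue.
  have hsep : ∀ q, SeparatedNhds (C ∩ c q) (D ∩ c q) := fun q =>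
    .of_isCompact_isCompact ((hcc q).inter_left hC) ((hcc q).inter_left hD)
      (hCD.mono Set.inter_subset_left Set.inter_subset_left)
  choose U V hU hV hCU hDV hUV using hsep
  refine ⟨⋃ q, U q ∩ c q, ⋃ q, V q ∩ c q, isOpen_iUnion fun q => (hU q).inter (hco q),
    isOpen_iUnion fun q => (hV q).inter (hco q),
    fun x hx => Set.mem_iUnion.2 ⟨x, hCU _ ⟨hx, rfl⟩, rfl⟩,
    fun x hx => Set.mem_iUnion.2 ⟨x, hDV _ ⟨hx, rfl⟩, rfl⟩, ?_⟩
  rw [Set.disjoint_left]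
  intro x hx hx'
  obtain ⟨q, hxU, hq⟩ := Set.mem_iUnion.1 hx
  obtain ⟨r, hxV, hr⟩ := Set.mem_iUnion.1 hx'
  obtain rfl : q = r := (Eq.symm hq).trans hr
  exact Set.disjoint_left.1 (hUV q) hxU hxV

variable [LocallyCompactSpace G] [MeasurableSpace G] [BorelSpace G]

/-- Two regular left-invariant measures that agree on an open compact subgroup are equal. -/
lemma MeasureTheory.Measure.eq_of_isMulLeftInvariant_of_regular (μ ν : Measure G) [μ.IsHaarMeasure]
    [μ.Regular] [ν.IsMulLeftInvariant] [ν.Regular] {H : Set G} (hHo : IsOpen H)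
    (hHc : IsCompact H) (hne : H.Nonempty) (h : ν H = μ H) : ν = μ := by
  have hc := Measure.isMulLeftInvariant_eq_smul_of_regular ν μ
  have h1 : (Measure.haarScalarFactor ν μ : ℝ≥0∞) * μ H = 1 * μ H := by
    have := congrArg (fun m : Measure G => m H) hc
    simp only [Measure.smul_apply, h] at this
    rw [one_mul]
    exact this.symm
  have h2 := (ENNReal.mul_left_inj (hHo.measure_pos μ hne).ne' hHc.measure_lt_top.ne).1 h1
  rw [hc, ENNReal.coe_eq_one.1 h2, one_smul]

/-- A compact open subgroup containing `g` is stable under right translation by `g`, so the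
translated measure agrees with `μ` on it and uniqueness applies. -/
lemma IsLocallyElliptic.isMulRightInvariant (hG : IsLocallyElliptic G) (μ : Measure G)
    [μ.IsHaarMeasure] [μ.Regular] : μ.IsMulRightInvariant := by
  constructor
  intro g
  obtain ⟨H, hHo, hHc, hgH⟩ := hG.exists_isCompact_isOpen_subgroup (isCompact_singleton (x := g))
  have hgH : g ∈ H := hgH rfl
  have : (μ.map (· * g)).Regular := Measure.Regular.map (Homeomorph.mulRight g)
  refine Measure.eq_of_isMulLeftInvariant_of_regular μ _ hHo hHc ⟨1, H.one_mem⟩ ?_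
  rw [Measure.map_apply (measurable_mul_const g) hHo.measurableSet]
  congr 1
  ext x
  exact H.mul_mem_cancel_right hgH

/-- Right invariance of `μ` makes the inverted measure left-invariant, and a subgroup is stable
under inversion. -/
lemma IsLocallyElliptic.isInvInvariant (hG : IsLocallyElliptic G) (μ : Measure G)
    [μ.IsHaarMeasure] [μ.Regular] : μ.IsInvInvariant := by
  have := hG.isMulRightInvariant μ
  constructor
  obtain ⟨H, hHo, hHc, -⟩ := hG.exists_isCompact_isOpen_subgroup (isCompact_singleton (x := (1 : G)))
  refine Measure.eq_of_isMulLeftInvariant_of_regular μ _ hHo hHc ⟨1, H.one_mem⟩ ?_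
  rw [Measure.inv_apply]
  congr 1
  ext x
  exact H.inv_mem_iff

end Group

/-! ### `σ`-compact sets -/

section SigmaCompact

variable {X : Type*} [TopologicalSpace X]

lemma IsSigmaCompact.sigmaFinite_restrict [MeasurableSpace X] [T2Space X] [OpensMeasurableSpace X] {S : Set X}
    (hS : IsSigmaCompact S) (μ : Measure X) [IsFiniteMeasureOnCompacts μ] :
    SigmaFinite (μ.restrict S) := by
  obtain ⟨K, hK, rfl⟩ := hS
  have hm : MeasurableSet (⋃ n, K n) := .iUnion fun n => (hK n).measurableSet
  -- The complement of the union is null for the restricted measure; adding it to every `K n` makes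
  -- these sets cover the space.
  refine ⟨⟨⟨fun n => K n ∪ (⋃ n, K n)ᶜ, fun _ => trivial, fun n => ?_, ?_⟩⟩⟩
  · refine (measure_union_le _ _).trans_lt (ENNReal.add_lt_top.2 ⟨?_, ?_⟩)
    · exact (Measure.restrict_apply_le _ _).trans_lt (hK n).measure_lt_top
    · rw [Measure.restrict_apply hm.compl, Set.compl_inter_self, measure_empty]
      exact ENNReal.zero_lt_top
  · rw [← Set.iUnion_union, Set.union_compl_self]

lemma IsSigmaCompact.union {S T : Set X} (hS : IsSigmaCompact S) (hT : IsSigmaCompact T) :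
    IsSigmaCompact (S ∪ T) := by
  rw [Set.union_eq_iUnion]
  exact isSigmaCompact_iUnion _ (by rintro (_ | _) <;> assumption)

lemma IsSigmaCompact.mul {G : Type*} [TopologicalSpace G] [Mul G] [ContinuousMul G] {S T : Set G}
    (hS : IsSigmaCompact S) (hT : IsSigmaCompact T) :
    IsSigmaCompact {x | ∃ a ∈ S, ∃ b ∈ T, a * b = x} := by
  obtain ⟨K, hK, rfl⟩ := hS
  obtain ⟨L, hL, rfl⟩ := hT
  have : {x | ∃ a ∈ ⋃ n, K n, ∃ b ∈ ⋃ n, L n, a * b = x} =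
      ⋃ n, ⋃ m, (fun p : G × G => p.1 * p.2) '' (K n ×ˢ L m) := by
    ext x
    simp only [Set.mem_iUnion, Set.mem_ofPred_eq, Set.mem_image, Set.mem_prod, Prod.exists]
    constructor
    · rintro ⟨a, ⟨n, hn⟩, b, ⟨m, hm⟩, h⟩
      exact ⟨n, m, a, b, ⟨hn, hm⟩, h⟩
    · rintro ⟨n, m, a, b, ⟨hn, hm⟩, h⟩
      exact ⟨a, ⟨n, hn⟩, b, ⟨m, hm⟩, h⟩
  rw [this]
  exact isSigmaCompact_iUnion _ fun n => isSigmaCompact_iUnion _ fun m =>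
    (((hK n).prod (hL m)).image continuous_mul).isSigmaCompact

end SigmaCompact

/-! ### Tonelli and Fubini on a square carrying the integrand -/

section Swap

variable {X : Type*} [MeasurableSpace X]

/-- Tonelli's theorem for functions that vanish off a square on which the measure is s-finite. -/
lemma lintegral_lintegral_swap_of_support {μ : Measure X} {S : Set X} [SFinite (μ.restrict S)]
    {W : X × X → ℝ≥0∞} (hW : Measurable W) (hS : ∀ p, W p ≠ 0 → p.1 ∈ S ∧ p.2 ∈ S) :
    ∫⁻ x, ∫⁻ y, W (x, y) ∂μ ∂μ = ∫⁻ y, ∫⁻ x, W (x, y) ∂μ ∂μ := by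
  have h1 : ∀ x, ∫⁻ y in S, W (x, y) ∂μ = ∫⁻ y, W (x, y) ∂μ := fun x =>
    setLIntegral_eq_of_support_subset fun y hy => (hS _ hy).2
  have h2 : ∀ y, ∫⁻ x in S, W (x, y) ∂μ = ∫⁻ x, W (x, y) ∂μ := fun y =>
    setLIntegral_eq_of_support_subset fun x hx => (hS _ hx).1
  have h3 : ∫⁻ x in S, ∫⁻ y in S, W (x, y) ∂μ ∂μ = ∫⁻ x, ∫⁻ y in S, W (x, y) ∂μ ∂μ := by
    refine setLIntegral_eq_of_support_subset fun x hx => ?_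
    by_contra hxS
    refine hx ((lintegral_congr fun y => ?_).trans lintegral_zero)
    by_contra h
    exact hxS (hS _ h).1
  have h4 : ∫⁻ y in S, ∫⁻ x in S, W (x, y) ∂μ ∂μ = ∫⁻ y, ∫⁻ x in S, W (x, y) ∂μ ∂μ := by
    refine setLIntegral_eq_of_support_subset fun x hx => ?_
    by_contra hxS
    refine hx ((lintegral_congr fun y => ?_).trans lintegral_zero)
    by_contra h
    exact hxS (hS _ h).2
  simp_rw [← h1, ← h2, ← h3, ← h4]
  exact lintegral_lintegral_swap hW.aemeasurable

/-- Fubini's theorem for functions that vanish off a square on which the measure is s-finite. -/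
lemma integral_integral_swap_of_support {μ : Measure X} {S : Set X} [SFinite (μ.restrict S)]
    {W : X × X → ℂ} (hW : StronglyMeasurable W) (hS : ∀ p, W p ≠ 0 → p.1 ∈ S ∧ p.2 ∈ S)
    (hfin : ∫⁻ x, ∫⁻ y, ‖W (x, y)‖ₑ ∂μ ∂μ < ∞) :
    ∫ x, ∫ y, W (x, y) ∂μ ∂μ = ∫ y, ∫ x, W (x, y) ∂μ ∂μ := by
  have h0 : ∀ p, ¬ (p.1 ∈ S ∧ p.2 ∈ S) → W p = 0 := fun p hp => by
    by_contra h
    exact hp (hS p h)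
  have h1 : ∀ x, ∫ y in S, W (x, y) ∂μ = ∫ y, W (x, y) ∂μ := fun x =>
    setIntegral_eq_integral_of_forall_compl_eq_zero fun y hy => h0 _ fun h => hy h.2
  have h2 : ∀ y, ∫ x in S, W (x, y) ∂μ = ∫ x, W (x, y) ∂μ := fun y =>
    setIntegral_eq_integral_of_forall_compl_eq_zero fun x hx => h0 _ fun h => hx h.1
  have h3 : ∫ x in S, ∫ y in S, W (x, y) ∂μ ∂μ = ∫ x, ∫ y in S, W (x, y) ∂μ ∂μ := by
    refine setIntegral_eq_integral_of_forall_compl_eq_zero fun x hx => ?_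
    simp [h0 (x, _) fun h => hx h.1]
  have h4 : ∫ y in S, ∫ x in S, W (x, y) ∂μ ∂μ = ∫ y, ∫ x in S, W (x, y) ∂μ ∂μ := by
    refine setIntegral_eq_integral_of_forall_compl_eq_zero fun y hy => ?_
    simp [h0 (_, y) fun h => hy h.2]
  simp_rw [← h1, ← h2, ← h3, ← h4]
  refine integral_integral_swap ⟨hW.aestronglyMeasurable, ?_⟩
  change ∫⁻ p, ‖W p‖ₑ ∂_ < ∞
  rw [lintegral_prod _ hW.enorm.aemeasurable]
  exact (lintegral_mono' Measure.restrict_le_self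
    fun x => lintegral_mono' Measure.restrict_le_self le_rfl).trans_lt hfin

end Swap

/-! ### Representatives that are measurable for the product `σ`-algebra -/

section Representatives

variable {G : Type*} [Group G] [TopologicalSpace G] [IsTopologicalGroup G]
  [LocallyCompactSpace G] [T2Space G] [NormalSpace G] [MeasurableSpace G] [BorelSpace G]

/-- An integrable function is an almost everywhere limit of a sequence in `C_c`. -/
lemma MeasureTheory.Integrable.exists_seq_hasCompactSupport_tendsto {X : Type*}
    [TopologicalSpace X] [R1Space X] [NormalSpace X] [WeaklyLocallyCompactSpace X] [MeasurableSpace X]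
    [BorelSpace X] {μ : Measure X} [μ.Regular] {f : X → ℂ} (hf : Integrable f μ) :
    ∃ φ : ℕ → X → ℂ, (∀ n, Continuous (φ n)) ∧ (∀ n, HasCompactSupport (φ n)) ∧
      ∀ᵐ x ∂μ, Tendsto (fun n => φ n x) atTop (𝓝 (f x)) := by
  have h : ∀ n : ℕ, ∃ g : X → ℂ, HasCompactSupport g ∧
      ∫⁻ x, ‖f x - g x‖ₑ ∂μ ≤ (n + 1 : ℝ≥0∞)⁻¹ ∧ Continuous g ∧ Integrable g μ := fun n =>
    hf.exists_hasCompactSupport_lintegral_sub_le (by simp)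
  choose g hgs hg hgc hgi using h
  have hT : TendstoInMeasure μ g atTop f := by
    refine tendstoInMeasure_of_tendsto_eLpNorm one_ne_zero
      (fun n => (hgi n).aestronglyMeasurable) hf.aestronglyMeasurable ?_
    have hlim : Tendsto (fun n : ℕ => (n + 1 : ℝ≥0∞)⁻¹) atTop (𝓝 0) := by
      have := (tendsto_add_atTop_iff_nat 1).2 ENNReal.tendsto_inv_nat_nhds_zero
      simpa using this
    refine tendsto_of_tendsto_of_tendsto_of_le_of_le tendsto_const_nhds hlim
      (fun _ => zero_le) fun n => ?_
    rw [eLpNorm_one_eq_lintegral_enorm]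
    refine le_of_eq_of_le (lintegral_congr fun x => ?_) (hg n)
    rw [Pi.sub_apply, ← enorm_neg, neg_sub]
  obtain ⟨ns, -, hns⟩ := hT.exists_seq_tendsto_ae
  exact ⟨fun n => g (ns n), fun n => hgc _, fun n => hgs _, hns⟩

/-- For `φ ∈ C_c(G)` and `K` compact, `(y, t) ↦ 1_K(y) φ(y⁻¹ t)` is measurable for the product
`σ`-algebra, although multiplication need not be. -/
lemma stronglyMeasurable_indicator_inv_mul {φ : G → ℂ} (hφ : Continuous φ)
    (hφs : HasCompactSupport φ) {K : Set G} (hK : IsCompact K) :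
    StronglyMeasurable (fun p : G × G => K.indicator (fun y => φ (y⁻¹ * p.2)) p.1) := by
  -- A cut-off equal to `1` on `K` turns the function into an element of `C_c(G × G)`, and such
  -- elements are measurable for the product `σ`-algebra.
  obtain ⟨χ, hχ1, -, hχs, -⟩ := exists_continuous_one_zero_of_isCompact hK
    (isClosed_empty (X := G)) (Set.disjoint_empty K)
  have hcont : Continuous (fun p : G × G => (χ p.1 : ℂ) * φ (p.1⁻¹ * p.2)) := by fun_prop
  have hsupp : HasCompactSupport (fun p : G × G => (χ p.1 : ℂ) * φ (p.1⁻¹ * p.2)) := by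
    refine HasCompactSupport.intro (K := (fun p : G × G => (p.1, p.1 * p.2)) ''
      (tsupport χ ×ˢ tsupport φ)) ((hχs.isCompact.prod hφs.isCompact).image (by fun_prop)) ?_
    rintro ⟨y, t⟩ h
    by_contra h0
    obtain ⟨h1, h2⟩ := mul_ne_zero_iff.1 h0
    refine h ⟨(y, y⁻¹ * t), ⟨subset_tsupport _ fun h => h1 (by simp [h]),
      subset_tsupport _ h2⟩, by simp⟩
  have := (hsupp.stronglyMeasurable_of_prod hcont).indicator
    (hK.measurableSet.prod (MeasurableSet.univ (α := G)))
  convert this using 1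
  ext ⟨y, t⟩
  by_cases hy : y ∈ K
  · simp [hy, hχ1 hy]
  · simp [hy]

/-- Every integrable function has a representative, supported in a `σ`-compact set, for which
`(y, t) ↦ f (y⁻¹ t)` is measurable on `K × G` for the product `σ`-algebra, for every compact `K`. -/
lemma MeasureTheory.Integrable.exists_representative {μ : Measure G} [μ.Regular] {f : G → ℂ}
    (hf : Integrable f μ) : ∃ f' : G → ℂ, f' =ᵐ[μ] f ∧ StronglyMeasurable f' ∧
      (∃ S : Set G, IsSigmaCompact S ∧ ∀ x, f' x ≠ 0 → x ∈ S) ∧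
      ∀ K : Set G, IsCompact K →
        StronglyMeasurable (fun p : G × G => K.indicator (fun y => f' (y⁻¹ * p.2)) p.1) := by
  obtain ⟨φ, hφc, hφs, hφ⟩ := hf.exists_seq_hasCompactSupport_tendsto
  -- The limit is taken at every point, with a fixed default value where it does not exist, so that
  -- measurability passes through translations exactly and not only almost everywhere. Where all `φ
  -- n` vanish the value is `0`.
  refine ⟨fun x => limUnder atTop fun n => φ n x, ?_, ?_, ?_, ?_⟩
  · filter_upwards [hφ] with x hx using hx.limUnder_eq
  · exact StronglyMeasurable.limUnder fun n =>
      (hφc n).stronglyMeasurable_of_hasCompactSupport (hφs n)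
  · refine ⟨⋃ n, tsupport (φ n), isSigmaCompact_iUnion _ fun n => (hφs n).isCompact.isSigmaCompact,
      fun x hx => ?_⟩
    by_contra h
    simp only [Set.mem_iUnion, not_exists] at h
    refine hx ?_
    simp only [fun n => image_eq_zero_of_notMem_tsupport (h n)]
    exact tendsto_const_nhds.limUnder_eq
  · intro K hK
    have := StronglyMeasurable.limUnder (l := atTop) fun n =>
      stronglyMeasurable_indicator_inv_mul (hφc n) (hφs n) hK
    convert this using 1
    ext ⟨y, t⟩
    by_cases hy : y ∈ K
    · simp [hy]
    · simp only [Set.indicator_of_notMem hy]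
      exact tendsto_const_nhds.limUnder_eq.symm

/-- Two integrable functions have representatives for which the integrand `f(y) g(y⁻¹ t)` of the
convolution is measurable for the product `σ`-algebra and supported in a `σ`-finite square. -/
lemma exists_representatives_conv {μ : Measure G} [μ.Regular] {f g : G → ℂ}
    (hf : Integrable f μ) (hg : Integrable g μ) :
    ∃ f' g' : G → ℂ, f' =ᵐ[μ] f ∧ g' =ᵐ[μ] g ∧ StronglyMeasurable f' ∧ StronglyMeasurable g' ∧
      StronglyMeasurable (fun p : G × G => f' p.1 * g' (p.1⁻¹ * p.2)) ∧
      ∃ S : Set G, IsSigmaCompact S ∧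
        ∀ p : G × G, f' p.1 * g' (p.1⁻¹ * p.2) ≠ 0 → p.1 ∈ S ∧ p.2 ∈ S := by
  obtain ⟨f', hff', hf'm, ⟨S, hS, hfS⟩, -⟩ := hf.exists_representative
  obtain ⟨g', hgg', hg'm, ⟨T, hT, hgT⟩, hg'⟩ := hg.exists_representative
  -- If `y ∈ S` and `y⁻¹ t ∈ T`, then `t` lies in the product set `S T`, which is again `σ`-compact.
  refine ⟨f', g', hff', hgg', hf'm, hg'm, ?_, S ∪ {x | ∃ a ∈ S, ∃ b ∈ T, a * b = x},
    hS.union (hS.mul hT), ?_⟩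
  · obtain ⟨K, hK, rfl⟩ := hS
    have hK' : ∀ n, IsCompact (Set.accumulate K n) := fun n =>
      isCompact_accumulate hK n
    refine stronglyMeasurable_of_tendsto (ι := ℕ) atTop (f := fun n (p : G × G) => f' p.1 *
      (Set.accumulate K n).indicator (fun y => g' (y⁻¹ * p.2)) p.1) (fun n =>
        (hf'm.comp_measurable measurable_fst).mul (hg' _ (hK' n))) ?_
    refine tendsto_pi_nhds.2 fun p => ?_
    by_cases hp : f' p.1 = 0
    · simp [hp]
    · obtain ⟨n, hn⟩ := Set.mem_iUnion.1 (hfS _ hp)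
      refine tendsto_const_nhds.congr' ?_
      filter_upwards [eventually_ge_atTop n] with m hm
      rw [Set.indicator_of_mem]
      exact Set.mem_accumulate.2 ⟨n, hm, hn⟩
  · intro p hp
    obtain ⟨h1, h2⟩ := mul_ne_zero_iff.1 hp
    exact ⟨Or.inl (hfS _ h1), Or.inr ⟨_, hfS _ h1, _, hgT _ h2, by simp⟩⟩

end Representatives

/-! ### Convolution of integrable functions -/

section Basic

variable {G : Type*} [Group G] [MeasurableSpace G] {μ : Measure G}

lemma groupConv_smul_left (c : ℂ) (f g : G → ℂ) :
    groupConv μ (c • f) g = c • groupConv μ f g := by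
  ext x
  simp only [groupConv, Pi.smul_apply, smul_eq_mul, mul_assoc]
  exact integral_const_mul _ _

lemma groupConv_smul_right (c : ℂ) (f g : G → ℂ) :
    groupConv μ f (c • g) = c • groupConv μ f g := by
  ext x
  simp only [groupConv, Pi.smul_apply, smul_eq_mul, mul_left_comm _ c]
  exact integral_const_mul _ _

lemma enorm_groupConv_le (f g : G → ℂ) (x : G) :
    ‖groupConv μ f g x‖ₑ ≤ ∫⁻ y, ‖f y‖ₑ * ‖g (y⁻¹ * x)‖ₑ ∂μ := by
  refine (enorm_integral_le_lintegral_enorm _).trans_eq ?_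
  simp_rw [enorm_mul]

end Basic

section Convolution

variable {G : Type*} [Group G] [TopologicalSpace G] [IsTopologicalGroup G]
  [MeasurableSpace G] [BorelSpace G]
  {μ : Measure G} [μ.IsMulRightInvariant] [μ.IsInvInvariant]

lemma measurePreserving_inv_mul_const (x : G) : MeasurePreserving (fun y => y⁻¹ * x) μ μ :=
  (measurePreserving_mul_right μ x).comp (Measure.measurePreserving_inv μ)

lemma ae_eq_comp_inv_mul {α : Type*} {g g' : G → α} (h : g =ᵐ[μ] g') (x : G) :
    (fun y => g (y⁻¹ * x)) =ᵐ[μ] fun y => g' (y⁻¹ * x) :=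
  (measurePreserving_inv_mul_const x).quasiMeasurePreserving.ae_eq_comp h

lemma lintegral_enorm_inv_mul (g : G → ℂ) (x : G) : ∫⁻ y, ‖g (y⁻¹ * x)‖ₑ ∂μ = ∫⁻ y, ‖g y‖ₑ ∂μ :=
  (measurePreserving_inv_mul_const x).lintegral_comp_emb
    ((MeasurableEquiv.inv G).trans (MeasurableEquiv.mulRight x)).measurableEmbedding
    (fun y => ‖g y‖ₑ)

/-- The convolution does not depend on the choice of representatives, even pointwise. -/
lemma groupConv_congr {f f' g g' : G → ℂ} (hf : f =ᵐ[μ] f') (hg : g =ᵐ[μ] g') :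
    groupConv μ f g = groupConv μ f' g' := by
  ext x
  refine integral_congr_ae ?_
  filter_upwards [hf, ae_eq_comp_inv_mul hg x] with y h1 h2
  rw [h1, h2]

lemma aestronglyMeasurable_conv_integrand {f g : G → ℂ} (hf : AEStronglyMeasurable f μ)
    (hg : AEStronglyMeasurable g μ) (x : G) :
    AEStronglyMeasurable (fun y => f y * g (y⁻¹ * x)) μ :=
  hf.mul (hg.comp_quasiMeasurePreserving (measurePreserving_inv_mul_const x).quasiMeasurePreserving)

variable [LocallyCompactSpace G] [T2Space G] [NormalSpace G] [μ.IsMulLeftInvariant] [μ.Regular]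

/-- Representatives of two functions `G → [0, ∞]` with finite integral. -/
lemma exists_representatives_lconv {F K : G → ℝ≥0∞} (hF : AEMeasurable F μ)
    (hF' : ∫⁻ x, F x ∂μ ≠ ∞) (hK : AEMeasurable K μ) (hK' : ∫⁻ x, K x ∂μ ≠ ∞) :
    ∃ W : G × G → ℝ≥0∞, Measurable W ∧
      (∃ S : Set G, IsSigmaCompact S ∧ ∀ p, W p ≠ 0 → p.1 ∈ S ∧ p.2 ∈ S) ∧
      (∀ x, ∀ᵐ y ∂μ, F y * K (y⁻¹ * x) = W (y, x)) ∧
      ∀ᵐ y ∂μ, ∀ᵐ x ∂μ, F y * K (y⁻¹ * x) = W (y, x) := by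
  -- A function with finite integral is finite almost everywhere, so it can be treated as a complex
  -- integrable function.
  have key : ∀ {L : G → ℝ≥0∞}, AEMeasurable L μ → ∫⁻ x, L x ∂μ ≠ ∞ →
      Integrable (fun x => ((L x).toReal : ℂ)) μ ∧
      (fun x => ‖((L x).toReal : ℂ)‖ₑ) =ᵐ[μ] L := fun hL hL' => by
    refine ⟨(integrable_toReal_of_lintegral_ne_top hL hL').ofReal, ?_⟩
    filter_upwards [ae_lt_top' hL hL'] with x hx
    rw [← ofReal_norm, Complex.norm_real, Real.norm_of_nonneg ENNReal.toReal_nonneg,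
      ENNReal.ofReal_toReal hx.ne]
  obtain ⟨hfi, hfe⟩ := key hF hF'
  obtain ⟨hgi, hge⟩ := key hK hK'
  obtain ⟨f', g', hf, hg, hfm, hgm, hfg, S, hS, hfgS⟩ := exists_representatives_conv hfi hgi
  have hF1 : (fun y => ‖f' y‖ₑ) =ᵐ[μ] F := (hf.fun_comp enorm).trans hfe
  have hK1 : (fun y => ‖g' y‖ₑ) =ᵐ[μ] K := (hg.fun_comp enorm).trans hge
  refine ⟨fun p => ‖f' p.1 * g' (p.1⁻¹ * p.2)‖ₑ, hfg.enorm, ⟨S, hS, fun p hp => hfgS p ?_⟩,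
    fun x => ?_, ?_⟩
  · simpa using hp
  · filter_upwards [hF1, ae_eq_comp_inv_mul hK1 x] with y h1 h2
    rw [enorm_mul, h1, h2]
  · filter_upwards [hF1] with y h1
    filter_upwards [(measurePreserving_mul_left μ y⁻¹).quasiMeasurePreserving.ae_eq_comp hK1]
      with x h2
    simp only [Function.comp_apply] at h2
    rw [enorm_mul, h1, h2]

lemma aemeasurable_lconv {F K : G → ℝ≥0∞} (hF : AEMeasurable F μ)
    (hF' : ∫⁻ x, F x ∂μ ≠ ∞) (hK : AEMeasurable K μ) (hK' : ∫⁻ x, K x ∂μ ≠ ∞) :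
    AEMeasurable (fun x => ∫⁻ y, F y * K (y⁻¹ * x) ∂μ) μ := by
  obtain ⟨W, hW, ⟨S, hS, hWS⟩, h1, -⟩ := exists_representatives_lconv hF hF' hK hK'
  have := hS.sigmaFinite_restrict μ
  have h2 : ∀ x, ∫⁻ y, F y * K (y⁻¹ * x) ∂μ = ∫⁻ y in S, W (y, x) ∂μ := fun x => by
    rw [lintegral_congr_ae (h1 x)]
    exact (setLIntegral_eq_of_support_subset fun y hy => (hWS _ hy).1).symm
  simp_rw [h2]
  exact hW.lintegral_prod_left'.aemeasurable

/-- Tonelli's theorem for convolutions, without countability assumptions on the group. -/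
lemma lintegral_mul_lconv {F K h : G → ℝ≥0∞} (hF : AEMeasurable F μ)
    (hF' : ∫⁻ x, F x ∂μ ≠ ∞) (hK : AEMeasurable K μ) (hK' : ∫⁻ x, K x ∂μ ≠ ∞)
    (hh : AEMeasurable h μ) :
    ∫⁻ x, h x * ∫⁻ y, F y * K (y⁻¹ * x) ∂μ ∂μ = ∫⁻ y, F y * ∫⁻ x, h x * K (y⁻¹ * x) ∂μ ∂μ := by
  obtain ⟨W, hW, ⟨S, hS, hWS⟩, h1, h2⟩ := exists_representatives_lconv hF hF' hK hK'
  have := hS.sigmaFinite_restrict μ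
  have e1 : ∫⁻ x, h x * ∫⁻ y, F y * K (y⁻¹ * x) ∂μ ∂μ =
      ∫⁻ x, ∫⁻ y, hh.mk h x * W (y, x) ∂μ ∂μ := by
    refine lintegral_congr_ae ?_
    filter_upwards [hh.ae_eq_mk] with x hx
    rw [lintegral_congr_ae (h1 x), hx]
    exact (lintegral_const_mul _ (hW.comp measurable_prodMk_right)).symm
  have e2 : ∫⁻ y, F y * ∫⁻ x, h x * K (y⁻¹ * x) ∂μ ∂μ =
      ∫⁻ y, ∫⁻ x, hh.mk h x * W (y, x) ∂μ ∂μ := by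
    refine lintegral_congr_ae ?_
    filter_upwards [h2] with y hy
    have hKy : AEMeasurable (fun x => K (y⁻¹ * x)) μ :=
      hK.comp_quasiMeasurePreserving (measurePreserving_mul_left μ y⁻¹).quasiMeasurePreserving
    refine (lintegral_const_mul'' _ (hh.mul hKy)).symm.trans (lintegral_congr_ae ?_)
    filter_upwards [hy, hh.ae_eq_mk] with x hx hx'
    rw [← hx, ← hx', Pi.mul_apply]
    ring
  rw [e1, e2]
  exact (lintegral_lintegral_swap_of_support (S := S) (W := fun p => hh.mk h p.2 * W p)
    ((hh.measurable_mk.comp measurable_snd).mul hW)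
    fun p hp => hWS p (right_ne_zero_of_mul hp)).symm

lemma lintegral_lconv {F K : G → ℝ≥0∞} (hF : AEMeasurable F μ)
    (hF' : ∫⁻ x, F x ∂μ ≠ ∞) (hK : AEMeasurable K μ) (hK' : ∫⁻ x, K x ∂μ ≠ ∞) :
    ∫⁻ x, ∫⁻ y, F y * K (y⁻¹ * x) ∂μ ∂μ = (∫⁻ x, F x ∂μ) * ∫⁻ x, K x ∂μ := by
  have := lintegral_mul_lconv hF hF' hK hK' (aemeasurable_const (b := 1))
  simp only [one_mul] at this
  rw [this, ← lintegral_mul_const'' _ hF]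
  refine lintegral_congr fun y => ?_
  rw [lintegral_mul_left_eq_self]

section Integrable

variable {f g h : G → ℂ} (hf : Integrable f μ) (hg : Integrable g μ) (hh : Integrable h μ)
include hf hg

lemma lintegral_lconv_enorm :
    ∫⁻ x, ∫⁻ y, ‖f y‖ₑ * ‖g (y⁻¹ * x)‖ₑ ∂μ ∂μ = (∫⁻ x, ‖f x‖ₑ ∂μ) * ∫⁻ x, ‖g x‖ₑ ∂μ :=
  lintegral_lconv hf.1.enorm hf.2.ne hg.1.enorm hg.2.ne

lemma aemeasurable_lconv_enorm :
    AEMeasurable (fun x => ∫⁻ y, ‖f y‖ₑ * ‖g (y⁻¹ * x)‖ₑ ∂μ) μ :=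
  aemeasurable_lconv hf.1.enorm hf.2.ne hg.1.enorm hg.2.ne

lemma lintegral_lconv_enorm_ne_top :
    ∫⁻ x, ∫⁻ y, ‖f y‖ₑ * ‖g (y⁻¹ * x)‖ₑ ∂μ ∂μ ≠ ∞ := by
  rw [lintegral_lconv_enorm hf hg]
  exact ENNReal.mul_ne_top hf.2.ne hg.2.ne

lemma ae_integrable_conv_integrand :
    ∀ᵐ x ∂μ, Integrable (fun y => f y * g (y⁻¹ * x)) μ := by
  filter_upwards [ae_lt_top' (aemeasurable_lconv_enorm hf hg)
    (lintegral_lconv_enorm_ne_top hf hg)] with x hx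
  refine ⟨aestronglyMeasurable_conv_integrand hf.1 hg.1 x, ?_⟩
  simpa only [HasFiniteIntegral, enorm_mul] using hx

/-- Fubini's theorem for convolutions, without countability assumptions on the group. -/
lemma aestronglyMeasurable_groupConv_and_integral_mul :
    AEStronglyMeasurable (groupConv μ f g) μ ∧
    ∀ k : G → ℂ, AEStronglyMeasurable k μ →
      ∫⁻ y, ‖f y‖ₑ * ∫⁻ x, ‖g (y⁻¹ * x)‖ₑ * ‖k x‖ₑ ∂μ ∂μ < ∞ →
      ∫ x, groupConv μ f g x * k x ∂μ = ∫ y, f y * ∫ x, g (y⁻¹ * x) * k x ∂μ ∂μ := by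
  obtain ⟨f', g', hff', hgg', hfm, hgm, hfg, S, hS, hfgS⟩ := exists_representatives_conv hf hg
  have := hS.sigmaFinite_restrict μ
  rw [← groupConv_congr hff' hgg']
  have h0 : ∀ p : G × G, ¬ (p.1 ∈ S ∧ p.2 ∈ S) → f' p.1 * g' (p.1⁻¹ * p.2) = 0 := fun p hp => by
    by_contra h
    exact hp (hfgS p h)
  have hgy : ∀ y, (fun x => g' (y⁻¹ * x)) =ᵐ[μ] fun x => g (y⁻¹ * x) := fun y =>
    (measurePreserving_mul_left μ y⁻¹).quasiMeasurePreserving.ae_eq_comp hgg'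
  refine ⟨?_, fun k hk hfin => ?_⟩
  · have h1 : groupConv μ f' g' = fun x => ∫ y in S, f' y * g' (y⁻¹ * x) ∂μ := by
      ext x
      exact (setIntegral_eq_integral_of_forall_compl_eq_zero fun y hy =>
        h0 (y, x) fun h => hy h.1).symm
    rw [h1]
    exact hfg.integral_prod_left'.aestronglyMeasurable
  · have hkm := hk.stronglyMeasurable_mk
    have e1 : ∫ x, groupConv μ f' g' x * k x ∂μ =
        ∫ x, ∫ y, f' y * g' (y⁻¹ * x) * hk.mk k x ∂μ ∂μ := by
      refine integral_congr_ae ?_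
      filter_upwards [hk.ae_eq_mk] with x hx
      rw [integral_mul_const, ← hx]
      rfl
    have e2 : ∫ y, f y * ∫ x, g (y⁻¹ * x) * k x ∂μ ∂μ =
        ∫ y, ∫ x, f' y * g' (y⁻¹ * x) * hk.mk k x ∂μ ∂μ := by
      refine integral_congr_ae ?_
      filter_upwards [hff'] with y hy
      rw [← integral_const_mul, hy]
      refine integral_congr_ae ?_
      filter_upwards [hgy y, hk.ae_eq_mk] with x h1 h2
      rw [h1, h2, mul_assoc]
    rw [e1, e2]
    refine (integral_integral_swap_of_support (S := S)
      (W := fun p => f' p.1 * g' (p.1⁻¹ * p.2) * hk.mk k p.2)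
      (hfg.mul (hkm.comp_measurable measurable_snd))
      (fun p hp => hfgS p (left_ne_zero_of_mul hp)) ?_).symm
    refine lt_of_eq_of_lt ?_ hfin
    refine lintegral_congr_ae ?_
    filter_upwards [hff'] with y hy
    have hm : AEMeasurable (fun x => ‖g (y⁻¹ * x)‖ₑ * ‖k x‖ₑ) μ :=
      (hg.1.comp_quasiMeasurePreserving
        (measurePreserving_mul_left μ y⁻¹).quasiMeasurePreserving).enorm.mul hk.enorm
    rw [← lintegral_const_mul'' _ hm, ← hy]
    refine lintegral_congr_ae ?_
    filter_upwards [hgy y, hk.ae_eq_mk] with x h1 h2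
    rw [← h1, ← h2, enorm_mul, enorm_mul, mul_assoc]

lemma MeasureTheory.Integrable.groupConv : Integrable (groupConv μ f g) μ :=
  ⟨(aestronglyMeasurable_groupConv_and_integral_mul hf hg).1,
    (lintegral_mono (enorm_groupConv_le f g)).trans_lt
      (lintegral_lconv_enorm_ne_top hf hg).lt_top⟩

lemma lintegral_enorm_groupConv_le :
    ∫⁻ x, ‖groupConv μ f g x‖ₑ ∂μ ≤ (∫⁻ x, ‖f x‖ₑ ∂μ) * ∫⁻ x, ‖g x‖ₑ ∂μ :=
  (lintegral_mono (enorm_groupConv_le f g)).trans_eq (lintegral_lconv_enorm hf hg)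

include hh

/-- Fubini's theorem tested against `t ↦ h (t⁻¹ * x)`. It applies at each `x` where the triple
convolution of absolute values is finite, hence almost everywhere. -/
lemma groupConv_assoc :
    groupConv μ (groupConv μ f g) h =ᵐ[μ] groupConv μ f (groupConv μ g h) := by
  have hfin : ∀ᵐ x ∂μ, ∫⁻ y, ‖f y‖ₑ * ∫⁻ t, ‖g t‖ₑ * ‖h (t⁻¹ * (y⁻¹ * x))‖ₑ ∂μ ∂μ < ∞ := by
    have hK := aemeasurable_lconv_enorm hg hh
    have hK' := lintegral_lconv_enorm_ne_top hg hh
    refine ae_lt_top' (aemeasurable_lconv hf.1.enorm hf.2.ne hK hK') ?_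
    rw [lintegral_lconv hf.1.enorm hf.2.ne hK hK']
    exact ENNReal.mul_ne_top hf.2.ne hK'
  filter_upwards [hfin] with x hx
  have key := (aestronglyMeasurable_groupConv_and_integral_mul hf hg).2 (fun t => h (t⁻¹ * x))
    (hh.1.comp_quasiMeasurePreserving
      (measurePreserving_inv_mul_const x).quasiMeasurePreserving) ?_
  · refine key.trans (integral_congr_ae (.of_forall fun y => ?_))
    have := integral_mul_left_eq_self (μ := μ) (fun s => g s * h (s⁻¹ * (y⁻¹ * x))) y⁻¹
    simp only [mul_inv_rev, inv_inv, mul_assoc, mul_inv_cancel_left] at this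
    simp only [this, groupConv]
  · refine lt_of_eq_of_lt (lintegral_congr fun y => ?_) hx
    have := lintegral_mul_left_eq_self (μ := μ) (fun s => ‖g s‖ₑ * ‖h (s⁻¹ * (y⁻¹ * x))‖ₑ) y⁻¹
    simp only [mul_inv_rev, inv_inv, mul_assoc, mul_inv_cancel_left] at this
    rw [this]

omit hh in
lemma groupConv_add_left (hh : Integrable h μ) :
    groupConv μ (f + g) h =ᵐ[μ] groupConv μ f h + groupConv μ g h := by
  filter_upwards [ae_integrable_conv_integrand hf hh, ae_integrable_conv_integrand hg hh]
    with x h1 h2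
  simp only [groupConv, Pi.add_apply, add_mul]
  exact integral_add h1 h2

lemma groupConv_add_right :
    groupConv μ f (g + h) =ᵐ[μ] groupConv μ f g + groupConv μ f h := by
  filter_upwards [ae_integrable_conv_integrand hf hg, ae_integrable_conv_integrand hf hh]
    with x h1 h2
  simp only [groupConv, Pi.add_apply, mul_add]
  exact integral_add h1 h2

end Integrable

end Convolution

/-! ### Young functions -/

section Young

variable {Φ Ψ : ℝ → ℝ≥0∞}

namespace IsYoungFunction

lemma mul_le (hΦ : IsYoungFunction Φ) {t : ℝ} (ht0 : 0 ≤ t) (ht : t ≤ 1) (x : ℝ) :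
    Φ (t * x) ≤ ENNReal.ofReal t * Φ x := by
  lift t to ℝ≥0 using ht0
  have ht : t ≤ 1 := by exact_mod_cast ht
  have := hΦ.convex.2 (Set.mem_univ x) (Set.mem_univ 0) (zero_le (a := t))
    (zero_le (a := 1 - t)) (add_tsub_cancel_of_le ht)
  simpa [hΦ.zero, NNReal.smul_def, ENNReal.smul_def] using this

lemma mono (hΦ : IsYoungFunction Φ) {x y : ℝ} (hx : 0 ≤ x) (hxy : x ≤ y) : Φ x ≤ Φ y := by
  rcases hx.eq_or_lt with rfl | hx'
  · simp [hΦ.zero]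
  have hy := hx'.trans_le hxy
  have ht := div_le_one_of_le₀ hxy hy.le
  have := hΦ.mul_le (by positivity) ht y
  rw [div_mul_cancel₀ _ hy.ne'] at this
  exact this.trans (mul_le_of_le_one_left' (ENNReal.ofReal_le_one.2 ht))

lemma measurable (hΦ : IsYoungFunction Φ) : Measurable Φ := by
  have h1 : Monotone fun x => Φ (max x 0) := fun x y hxy =>
    hΦ.mono (le_max_right _ _) (max_le_max_right _ hxy)
  have h2 : Φ = (fun x => Φ (max x 0)) ∘ fun x => |x| := by
    ext x
    simp only [Function.comp_apply, max_eq_left (abs_nonneg x)]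
    rcases abs_choice x with h | h <;> simp [h, hΦ.even]
  rw [h2]
  exact h1.measurable.comp measurable_norm

lemma comp_norm_aemeasurable (hΦ : IsYoungFunction Φ) {X E : Type*} [MeasurableSpace X]
    [NormedAddCommGroup E] {μ : Measure X} {f : X → E} (hf : AEStronglyMeasurable f μ) (α : ℝ) :
    AEMeasurable (fun x => Φ (α * ‖f x‖)) μ :=
  hΦ.measurable.comp_aemeasurable (hf.norm.aemeasurable.const_mul α)

/-- The hypothesis says that `z` is at most the mean of `x` and `y`, hence at most the larger of the
two; monotonicity suffices. -/
lemma add_le (hΦ : IsYoungFunction Φ) {x y z : ℝ} (hz : 0 ≤ z)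
    (h : 2 * z ≤ x + y) : Φ z ≤ Φ x + Φ y := by
  rcases le_total x y with hxy | hxy
  · exact (hΦ.mono hz (by linarith)).trans le_add_self
  · exact (hΦ.mono hz (by linarith)).trans le_self_add

/-- A supporting-line inequality for the line of slope `Φ m / m` through `(m, 0)`. -/
lemma mul_le_add (hΦ : IsYoungFunction Φ) {m s : ℝ} (hm : 0 ≤ m) (hs : 0 ≤ s) {c : ℝ≥0∞}
    (hc : c ≤ Φ m) :
    c * ENNReal.ofReal s ≤ ENNReal.ofReal m * Φ s + ENNReal.ofReal m * c := by
  rcases le_total s m with h | h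
  · rw [mul_comm c]
    exact (mul_le_mul_left (ENNReal.ofReal_le_ofReal h) c).trans le_add_self
  rcases hs.eq_or_lt with rfl | hs'
  · simp
  refine le_add_right ?_
  have h1 := hΦ.mul_le (by positivity) (div_le_one_of_le₀ h hs) s
  rw [div_mul_cancel₀ _ hs'.ne'] at h1
  have h2 : ENNReal.ofReal (m / s) * ENNReal.ofReal s = ENNReal.ofReal m := by
    rw [← ENNReal.ofReal_mul (by positivity), div_mul_cancel₀ _ hs'.ne']
  calc c * ENNReal.ofReal s ≤ _ * Φ s * ENNReal.ofReal s := by gcongr; exact hc.trans h1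
    _ = ENNReal.ofReal m * Φ s := by rw [mul_right_comm, h2]

end IsYoungFunction

namespace IsComplementaryPair

lemma young_inequality (h : IsComplementaryPair Φ Ψ) {x y : ℝ} (hx : 0 ≤ x) (hy : 0 ≤ y) :
    ENNReal.ofReal (x * y) ≤ Φ x + Ψ y := by
  have := le_iSup (fun t : ℝ≥0 => ENNReal.ofReal ((t : ℝ) * |y|) - Φ (t : ℝ)) x.toNNReal
  rw [Real.coe_toNNReal _ hx, tsub_le_iff_left] at this
  rw [h.eq_complementary]
  nth_rw 1 [← abs_of_nonneg hy]
  exact this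

/-- If `Φ` were infinite on `(0, ∞)`, then `Ψ` would vanish identically, against `Ψ y → ∞`. This
makes bounded functions supported on sets of finite measure belong to `L^Φ`. -/
lemma exists_pos_ne_top (h : IsComplementaryPair Φ Ψ) : ∃ x, 0 < x ∧ Φ x ≠ ∞ := by
  by_contra! hcon
  have h0 : ∀ y, Ψ y = 0 := fun y => by
    rw [h.eq_complementary, complementaryFunction]
    refine le_antisymm (iSup_le fun x => ?_) zero_le
    rcases eq_or_ne x 0 with rfl | hx
    · simp
    · simp [hcon x (by positivity)]
  have h1 := h.right.tendsto
  simp only [show Ψ = fun _ => 0 from funext h0] at h1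
  exact ENNReal.zero_ne_top (tendsto_nhds_unique tendsto_const_nhds h1)

end IsComplementaryPair

end Young

/-! ### Orlicz spaces and the embedding into `L¹` -/

section Orlicz

variable {X : Type*} [MeasurableSpace X] {μ : Measure X} {Φ Ψ : ℝ → ℝ≥0∞} {f g : X → ℂ}

lemma MemOrlicz.congr (hf : MemOrlicz Φ μ f) (hfg : f =ᵐ[μ] g) : MemOrlicz Φ μ g := by
  obtain ⟨hm, α, hα, h⟩ := hf
  refine ⟨hm.congr hfg, α, hα, lt_of_eq_of_lt (lintegral_congr_ae ?_) h⟩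
  filter_upwards [hfg] with x hx
  rw [hx]

lemma MemOrlicz.add (hΦ : IsYoungFunction Φ) (hf : MemOrlicz Φ μ f) (hg : MemOrlicz Φ μ g) :
    MemOrlicz Φ μ (f + g) := by
  obtain ⟨hfm, α, hα, h⟩ := hf
  obtain ⟨hgm, β, hβ, h'⟩ := hg
  have hmin : 0 < min α β := lt_min hα hβ
  refine ⟨hfm.add hgm, min α β / 2, by positivity, lt_of_le_of_lt (lintegral_mono
    (g := fun x => Φ (α * ‖f x‖) + Φ (β * ‖g x‖)) fun x => ?_) ?_⟩
  · refine hΦ.add_le (by positivity) ?_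
    calc 2 * (min α β / 2 * ‖(f + g) x‖) = min α β * ‖f x + g x‖ := by rw [Pi.add_apply]; ring
      _ ≤ min α β * (‖f x‖ + ‖g x‖) := by gcongr; exact norm_add_le _ _
      _ = min α β * ‖f x‖ + min α β * ‖g x‖ := by ring
      _ ≤ α * ‖f x‖ + β * ‖g x‖ := by gcongr <;> simp
  · rw [lintegral_add_left' (hΦ.comp_norm_aemeasurable hfm α)]
    exact ENNReal.add_lt_top.2 ⟨h, h'⟩

lemma MemOrlicz.const_smul (hΦ : IsYoungFunction Φ) (hf : MemOrlicz Φ μ f) (c : ℂ) :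
    MemOrlicz Φ μ (c • f) := by
  obtain ⟨hfm, α, hα, h⟩ := hf
  refine ⟨hfm.const_smul c, α / (‖c‖ + 1), by positivity, (lintegral_mono fun x => ?_).trans_lt h⟩
  refine hΦ.mono (by positivity) ?_
  rw [Pi.smul_apply, norm_smul, div_mul_eq_mul_div, mul_div_assoc]
  refine mul_le_mul_of_nonneg_left ?_ hα.le
  rw [div_le_iff₀ (by positivity)]
  nlinarith [norm_nonneg c, norm_nonneg (f x)]

variable {ω : X → ℝ}

lemma weightedOrliczNorm_le_iff {B : ℝ≥0∞} : weightedOrliczNorm Ψ ω μ f ≤ B ↔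
    ∀ g : X → ℂ, AEStronglyMeasurable g μ → ∫⁻ x, Ψ ‖g x‖ ∂μ ≤ 1 →
      ∫⁻ x, ‖f x * ω x * g x‖ₑ ∂μ ≤ B := by
  simp only [weightedOrliczNorm, orliczNorm, iSup_le_iff]

lemma lintegral_le_weightedOrliczNorm (hg : AEStronglyMeasurable g μ)
    (h : ∫⁻ x, Ψ ‖g x‖ ∂μ ≤ 1) :
    ∫⁻ x, ‖f x * ω x * g x‖ₑ ∂μ ≤ weightedOrliczNorm Ψ ω μ f :=
  weightedOrliczNorm_le_iff.1 le_rfl g hg h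

lemma weightedOrliczNorm_congr (h : f =ᵐ[μ] g) :
    weightedOrliczNorm Ψ ω μ f = weightedOrliczNorm Ψ ω μ g := by
  simp only [weightedOrliczNorm, orliczNorm]
  refine iSup_congr fun k => iSup_congr fun _ => iSup_congr fun _ => ?_
  refine lintegral_congr_ae ?_
  filter_upwards [h] with x hx
  rw [hx]

lemma weightedOrliczNorm_add_le (hω : Measurable ω) (hf : AEStronglyMeasurable f μ) :
    weightedOrliczNorm Ψ ω μ (f + g) ≤
      weightedOrliczNorm Ψ ω μ f + weightedOrliczNorm Ψ ω μ g := by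
  refine weightedOrliczNorm_le_iff.2 fun k hk hk1 => ?_
  have hm : AEMeasurable (fun x => ‖f x * ω x * k x‖ₑ) μ :=
    ((hf.mul (Complex.measurable_ofReal.comp hω).aestronglyMeasurable).mul hk).enorm
  calc ∫⁻ x, ‖(f + g) x * ω x * k x‖ₑ ∂μ
      ≤ ∫⁻ x, (‖f x * ω x * k x‖ₑ + ‖g x * ω x * k x‖ₑ) ∂μ := by
        refine lintegral_mono fun x => ?_
        rw [Pi.add_apply, add_mul, add_mul]
        exact enorm_add_le _ _
    _ = _ := lintegral_add_left' hm _
    _ ≤ _ := add_le_add (lintegral_le_weightedOrliczNorm hk hk1)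
        (lintegral_le_weightedOrliczNorm hk hk1)

lemma weightedOrliczNorm_const_smul_le (c : ℂ) :
    weightedOrliczNorm Ψ ω μ (c • f) ≤ ‖c‖ₑ * weightedOrliczNorm Ψ ω μ f := by
  refine weightedOrliczNorm_le_iff.2 fun k hk hk1 => ?_
  simp only [Pi.smul_apply, smul_eq_mul, mul_assoc c, enorm_mul c]
  rw [lintegral_const_mul' _ _ enorm_ne_top]
  exact mul_le_mul_right (lintegral_le_weightedOrliczNorm hk hk1) _

lemma weightedOrliczSpace_congr (hf : f ∈ weightedOrliczSpace Φ Ψ ω μ) (h : f =ᵐ[μ] g) :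
    g ∈ weightedOrliczSpace Φ Ψ ω μ :=
  ⟨hf.1.congr h, weightedOrliczNorm_congr (Ψ := Ψ) (ω := ω) h ▸ hf.2⟩

lemma weightedOrliczSpace_add (hΦ : IsYoungFunction Φ) (hω : Measurable ω)
    (hf : f ∈ weightedOrliczSpace Φ Ψ ω μ) (hg : g ∈ weightedOrliczSpace Φ Ψ ω μ) :
    f + g ∈ weightedOrliczSpace Φ Ψ ω μ :=
  ⟨hf.1.add hΦ hg.1, (weightedOrliczNorm_add_le hω hf.1.1).trans_lt
    (ENNReal.add_lt_top.2 ⟨hf.2, hg.2⟩)⟩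

lemma weightedOrliczSpace_const_smul (hΦ : IsYoungFunction Φ) (c : ℂ)
    (hf : f ∈ weightedOrliczSpace Φ Ψ ω μ) : c • f ∈ weightedOrliczSpace Φ Ψ ω μ :=
  ⟨hf.1.const_smul hΦ c, (weightedOrliczNorm_const_smul_le c).trans_lt
    (ENNReal.mul_lt_top enorm_lt_top hf.2)⟩

lemma weightedOrliczSpace_sub (hΦ : IsYoungFunction Φ) (hω : Measurable ω)
    (hf : f ∈ weightedOrliczSpace Φ Ψ ω μ) (hg : g ∈ weightedOrliczSpace Φ Ψ ω μ) :
    f - g ∈ weightedOrliczSpace Φ Ψ ω μ := by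
  have := weightedOrliczSpace_add hΦ hω hf (weightedOrliczSpace_const_smul hΦ (-1) hg)
  rwa [neg_one_smul, ← sub_eq_add_neg] at this

/-- If `1/ω ∈ L^Ψ` then `L^Φ(ω) ⊆ L¹`. -/
lemma weightedOrliczSpace_subset_integrable (hΨ : IsYoungFunction Ψ) (hω : ∀ x, 1 ≤ ω x)
    (hinv : MemOrlicz Ψ μ (fun x => 1 / ω x)) (hf : f ∈ weightedOrliczSpace Φ Ψ ω μ) :
    Integrable f μ := by
  obtain ⟨hm, α, hα, h⟩ := hinv
  set I := ∫⁻ x, Ψ (α * ‖1 / ω x‖) ∂μ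
  -- By convexity, scaling by `t` brings the modular of `α / ω` down to at most `t I ≤ 1`, so `t α /
  -- ω` is an admissible test function. The `+ 1` covers `I = 0` and gives `t ≤ 1`.
  let t : ℝ≥0 := (I.toNNReal + 1)⁻¹
  have ht : t ≤ 1 := inv_le_one_of_one_le₀ le_add_self
  have ht0 : 0 < t := inv_pos.2 (by positivity)
  have htI : (t : ℝ≥0∞) * I ≤ 1 := by
    rw [← ENNReal.coe_toNNReal h.ne, ← ENNReal.coe_mul, ← ENNReal.coe_one, ENNReal.coe_le_coe,
      inv_mul_le_iff₀ (by positivity), mul_one]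
    exact le_self_add
  let k : X → ℂ := fun x => (((t : ℝ) * α * (1 / ω x) : ℝ) : ℂ)
  have hk : AEStronglyMeasurable k μ :=
    Complex.continuous_ofReal.comp_aestronglyMeasurable (hm.const_mul _)
  have hk1 : ∫⁻ x, Ψ ‖k x‖ ∂μ ≤ 1 := by
    refine le_trans (lintegral_mono (g := fun x => (t : ℝ≥0∞) * Ψ (α * ‖1 / ω x‖)) fun x => ?_) ?_
    · have : Ψ (t * (α * ‖1 / ω x‖)) ≤ ENNReal.ofReal (t : ℝ) * Ψ (α * ‖1 / ω x‖) :=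
        hΨ.mul_le t.2 ht _
      rw [ENNReal.ofReal_coe_nnreal] at this
      rwa [show ‖k x‖ = t * (α * ‖1 / ω x‖) by
        simp only [k, Complex.norm_real, norm_mul, Real.norm_of_nonneg hα.le,
          mul_assoc, show ‖(t : ℝ)‖ = t from Real.norm_of_nonneg t.2]]
    · rwa [lintegral_const_mul' _ _ ENNReal.coe_ne_top]
  have hle := (lintegral_le_weightedOrliczNorm (f := f) (ω := ω) hk hk1).trans_lt hf.2
  have hc : ∀ x, ‖f x * ω x * k x‖ₑ = ‖((t * α : ℝ) : ℂ)‖ₑ * ‖f x‖ₑ := fun x => by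
    rw [← enorm_mul]
    congr 1
    have : (ω x : ℂ) ≠ 0 := by
      exact_mod_cast (zero_lt_one.trans_le (hω x)).ne'
    simp only [k, Complex.ofReal_mul, Complex.ofReal_div, Complex.ofReal_one]
    field_simp
  simp_rw [hc] at hle
  rw [lintegral_const_mul' _ _ enorm_ne_top] at hle
  refine ⟨hf.1.1, ?_⟩
  have h0 : ‖((t * α : ℝ) : ℂ)‖ₑ ≠ 0 := by
    rw [enorm_ne_zero, Complex.ofReal_ne_zero]
    have : (0 : ℝ) < t := by exact_mod_cast ht0
    positivity
  exact (ENNReal.mul_lt_top_iff.1 hle).elim (fun h => h.2) fun h => h.elim (fun h => absurd h h0)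
    fun h => by simp [HasFiniteIntegral, h]

/-- A bounded function that vanishes off a set of finite measure on which `ω` is bounded belongs
to the weighted Orlicz space. -/
lemma mem_weightedOrliczSpace_of_bounded (h : IsComplementaryPair Φ Ψ) (hω : ∀ x, 1 ≤ ω x)
    {K : Set X} (hK : MeasurableSet K) (hμK : μ K ≠ ∞) {B M : ℝ} (hB : ∀ x ∈ K, ω x ≤ B)
    (hf : AEStronglyMeasurable f μ) (hfM : ∀ x, ‖f x‖ ≤ M) (hfK : ∀ x ∉ K, f x = 0) :
    f ∈ weightedOrliczSpace Φ Ψ ω μ := by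
  obtain ⟨x₀, hx₀, hfin⟩ := h.exists_pos_ne_top
  have key : ∀ (k : X → ℝ) (L : ℝ), (∀ x, 0 ≤ k x) → (∀ x, k x ≤ L) → (∀ x ∉ K, k x = 0) →
      ∃ β : ℝ, 0 < β ∧ ∫⁻ x, Φ (β * k x) ∂μ < ∞ := fun k L hk0 hkL hkK => by
    -- With this scaling `β k ≤ x₀` on `K`, so the integrand is dominated by `Φ x₀` times the
    -- indicator of `K`.
    refine ⟨x₀ / (|L| + 1), by positivity, ?_⟩
    calc ∫⁻ x, Φ (x₀ / (|L| + 1) * k x) ∂μ ≤ ∫⁻ x, K.indicator (fun _ => Φ x₀) x ∂μ := by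
          refine lintegral_mono fun x => ?_
          by_cases hx : x ∈ K
          · rw [Set.indicator_of_mem hx]
            refine h.left.mono (mul_nonneg (by positivity) (hk0 x)) ?_
            rw [div_mul_eq_mul_div, div_le_iff₀ (by positivity)]
            have := (hkL x).trans (le_abs_self L)
            gcongr
            linarith
          · simp [hkK x hx, h.left.zero]
      _ = Φ x₀ * μ K := by rw [lintegral_indicator hK, lintegral_const, Measure.restrict_apply_univ]
      _ < ∞ := ENNReal.mul_lt_top hfin.lt_top hμK.lt_top
  refine ⟨⟨hf, key (fun x => ‖f x‖) M (fun _ => norm_nonneg _) hfM fun x hx => by simp [hfK x hx]⟩,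
    ?_⟩
  obtain ⟨β, hβ, hβfin⟩ := key (fun x => ‖f x * ω x‖) (|M| * |B|) (fun _ => norm_nonneg _)
    (fun x => by
      by_cases hx : x ∈ K
      · rw [norm_mul, Complex.norm_real, Real.norm_of_nonneg (zero_le_one.trans (hω x))]
        exact mul_le_mul ((hfM x).trans (le_abs_self M)) ((hB x hx).trans (le_abs_self B))
          (zero_le_one.trans (hω x)) (abs_nonneg _)
      · rw [hfK x hx, zero_mul, norm_zero]
        positivity)
    fun x hx => by simp [hfK x hx]
  -- Integrating Young's inequality for `β |f ω|` and `|g|` bounds `β ∫ |f ω g|` by `∫ Φ(β |f ω|) +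
  -- 1`, uniformly in `g`.
  refine lt_of_le_of_lt (b := (ENNReal.ofReal β)⁻¹ * (∫⁻ x, Φ (β * ‖f x * ω x‖) ∂μ + 1))
    (weightedOrliczNorm_le_iff.2 fun g hg hg1 => ?_) ?_
  · have h0 : ENNReal.ofReal β ≠ 0 := by simpa using hβ
    rw [← ENNReal.div_eq_inv_mul, ENNReal.le_div_iff_mul_le (Or.inl h0) (Or.inl ENNReal.ofReal_ne_top),
      mul_comm, ← lintegral_const_mul' _ _ ENNReal.ofReal_ne_top]
    calc ∫⁻ x, ENNReal.ofReal β * ‖f x * ω x * g x‖ₑ ∂μ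
        ≤ ∫⁻ x, (Φ (β * ‖f x * ω x‖) + Ψ ‖g x‖) ∂μ := by
          refine lintegral_mono fun x => ?_
          have := h.young_inequality (mul_nonneg hβ.le (norm_nonneg (f x * ω x)))
            (norm_nonneg (g x))
          rwa [mul_assoc, ← norm_mul, ENNReal.ofReal_mul hβ.le, ofReal_norm] at this
      _ = _ := lintegral_add_right' _ (by
          simpa using h.right.comp_norm_aemeasurable hg 1)
      _ ≤ _ := by gcongr
  · exact ENNReal.mul_lt_top (ENNReal.inv_lt_top.2 (by simpa using hβ))
      (ENNReal.add_lt_top.2 ⟨hβfin, ENNReal.one_lt_top⟩)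

end Orlicz

/-! ### Truncated weighted norms -/

section TruncatedNorm

variable {X : Type*} [MeasurableSpace X]

/-- The weighted Orlicz norm with the weight and the test functions truncated at height `n`. It is
finite on `L¹`, and the weighted Orlicz norm is its supremum over `n`. -/
noncomputable def truncatedNorm (Ψ : ℝ → ℝ≥0∞) (ω : X → ℝ) (μ : Measure X) (n : ℕ) (f : X → ℂ) :
    ℝ≥0∞ :=
  ⨆ (g : X → ℂ) (_ : AEStronglyMeasurable g μ) (_ : ∫⁻ x, Ψ ‖g x‖ ∂μ ≤ 1),
    ∫⁻ x, min ‖g x‖ₑ n * (min (ENNReal.ofReal (ω x)) n * ‖f x‖ₑ) ∂μ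

variable {Ψ : ℝ → ℝ≥0∞} {ω : X → ℝ} {μ : Measure X} {n : ℕ} {f g : X → ℂ}

lemma truncatedNorm_le_iff {B : ℝ≥0∞} : truncatedNorm Ψ ω μ n f ≤ B ↔
    ∀ g : X → ℂ, AEStronglyMeasurable g μ → ∫⁻ x, Ψ ‖g x‖ ∂μ ≤ 1 →
      ∫⁻ x, min ‖g x‖ₑ n * (min (ENNReal.ofReal (ω x)) n * ‖f x‖ₑ) ∂μ ≤ B := by
  simp only [truncatedNorm, iSup_le_iff]

lemma lintegral_le_truncatedNorm (hg : AEStronglyMeasurable g μ) (h : ∫⁻ x, Ψ ‖g x‖ ∂μ ≤ 1) :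
    ∫⁻ x, min ‖g x‖ₑ n * (min (ENNReal.ofReal (ω x)) n * ‖f x‖ₑ) ∂μ ≤ truncatedNorm Ψ ω μ n f :=
  truncatedNorm_le_iff.1 le_rfl g hg h

lemma truncatedNorm_congr (h : f =ᵐ[μ] g) :
    truncatedNorm Ψ ω μ n f = truncatedNorm Ψ ω μ n g := by
  refine iSup_congr fun k => iSup_congr fun _ => iSup_congr fun _ => ?_
  refine lintegral_congr_ae ?_
  filter_upwards [h] with x hx
  rw [hx]

omit [MeasurableSpace X] in
lemma enorm_mul_weight (hω : ∀ x, 1 ≤ ω x) (x : X) :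
    ‖f x * ω x * g x‖ₑ = ‖g x‖ₑ * (ENNReal.ofReal (ω x) * ‖f x‖ₑ) := by
  rw [enorm_mul, enorm_mul, ← ofReal_norm (ω x : ℂ), Complex.norm_real,
    Real.norm_of_nonneg (zero_le_one.trans (hω x))]
  ring

lemma truncatedNorm_le_weightedOrliczNorm (hω : ∀ x, 1 ≤ ω x) :
    truncatedNorm Ψ ω μ n f ≤ weightedOrliczNorm Ψ ω μ f := by
  refine truncatedNorm_le_iff.2 fun g hg hg1 => le_trans (lintegral_mono fun x => ?_)
    (lintegral_le_weightedOrliczNorm hg hg1)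
  rw [enorm_mul_weight hω]
  gcongr <;> exact min_le_left _ _

/-- Weight and test function together contribute at most `n²`. This finiteness is what later permits
subtracting half of the norm from both sides. -/
lemma truncatedNorm_ne_top (hf : Integrable f μ) : truncatedNorm Ψ ω μ n f ≠ ∞ := by
  refine (lt_of_le_of_lt (truncatedNorm_le_iff.2 fun g _ _ => le_trans (lintegral_mono
    (g := fun x => (n * n : ℝ≥0∞) * ‖f x‖ₑ) fun x => ?_) (lintegral_const_mul' _ _ ?_).le) ?_).ne
  · dsimp only
    rw [mul_assoc]
    gcongr <;> exact min_le_right _ _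
  · exact ENNReal.mul_ne_top (ENNReal.natCast_ne_top n) (ENNReal.natCast_ne_top n)
  · exact ENNReal.mul_lt_top (ENNReal.mul_lt_top (ENNReal.natCast_lt_top n)
      (ENNReal.natCast_lt_top n)) hf.2

lemma truncatedNorm_add_le (hω : Measurable ω) (hf : AEStronglyMeasurable f μ) :
    truncatedNorm Ψ ω μ n (f + g) ≤ truncatedNorm Ψ ω μ n f + truncatedNorm Ψ ω μ n g := by
  refine truncatedNorm_le_iff.2 fun k hk hk1 => ?_
  have hm : AEMeasurable
      (fun x => min ‖k x‖ₑ n * (min (ENNReal.ofReal (ω x)) n * ‖f x‖ₑ)) μ :=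
    (hk.enorm.min aemeasurable_const).mul
      ((hω.ennreal_ofReal.aemeasurable.min aemeasurable_const).mul hf.enorm)
  refine le_trans (lintegral_mono fun x => ?_) ((lintegral_add_left' hm _).le.trans
    (add_le_add (lintegral_le_truncatedNorm hk hk1) (lintegral_le_truncatedNorm (f := g) hk hk1)))
  simp only [← mul_add]
  gcongr
  exact enorm_add_le _ _

/-- Monotone convergence for each fixed test function. -/
lemma weightedOrliczNorm_le_of_truncatedNorm_le (hω : ∀ x, 1 ≤ ω x) (hωm : Measurable ω)
    (hf : AEStronglyMeasurable f μ) {B : ℝ≥0∞} (h : ∀ n, truncatedNorm Ψ ω μ n f ≤ B) :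
    weightedOrliczNorm Ψ ω μ f ≤ B := by
  refine weightedOrliczNorm_le_iff.2 fun g hg hg1 => ?_
  simp_rw [enorm_mul_weight hω]
  have hlim := lintegral_tendsto_of_tendsto_of_monotone (μ := μ)
    (f := fun (n : ℕ) x => min ‖g x‖ₑ n * (min (ENNReal.ofReal (ω x)) n * ‖f x‖ₑ))
    (F := fun x => ‖g x‖ₑ * (ENNReal.ofReal (ω x) * ‖f x‖ₑ))
    (fun n => (hg.enorm.min aemeasurable_const).mul
      ((hωm.ennreal_ofReal.aemeasurable.min aemeasurable_const).mul hf.enorm))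
    (.of_forall fun x n m hnm => by
      have : (n : ℝ≥0∞) ≤ m := by exact_mod_cast hnm
      dsimp only
      gcongr) ?_
  · exact le_of_tendsto' hlim fun n => truncatedNorm_le_iff.1 (h n) g hg hg1
  · refine .of_forall fun x => tendsto_const_nhds.congr' ?_
    obtain ⟨a, ha⟩ := ENNReal.exists_nat_gt (enorm_ne_top (x := g x))
    obtain ⟨b, hb⟩ := ENNReal.exists_nat_gt (ENNReal.ofReal_ne_top (r := ω x))
    filter_upwards [eventually_ge_atTop a, eventually_ge_atTop b] with n hna hnb
    have h1 : (a : ℝ≥0∞) ≤ n := by exact_mod_cast hna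
    have h2 : (b : ℝ≥0∞) ≤ n := by exact_mod_cast hnb
    rw [min_eq_left (ha.le.trans h1), min_eq_left (hb.le.trans h2)]

end TruncatedNorm

/-! ### Leibniz inequality, and `L^Φ` under convolution by `L¹` -/

section Convolution

variable {G : Type*} [Group G] [TopologicalSpace G] [IsTopologicalGroup G]
  [MeasurableSpace G] [BorelSpace G] [LocallyCompactSpace G] [T2Space G] [NormalSpace G]
  {μ : Measure G} [μ.IsMulLeftInvariant] [μ.IsMulRightInvariant] [μ.IsInvInvariant] [μ.Regular]
  {Φ Ψ : ℝ → ℝ≥0∞} {ω : G → ℝ}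

/-- Moves the translation from `K` onto `h`, where it is harmless once `h` ranges over a
translation-invariant class of test functions. -/
lemma lintegral_mul_lconv_left {F K h : G → ℝ≥0∞} (hF : AEMeasurable F μ)
    (hF' : ∫⁻ x, F x ∂μ ≠ ∞) (hK : AEMeasurable K μ) (hK' : ∫⁻ x, K x ∂μ ≠ ∞)
    (hh : AEMeasurable h μ) :
    ∫⁻ x, h x * ∫⁻ y, F y * K (y⁻¹ * x) ∂μ ∂μ = ∫⁻ y, F y * ∫⁻ x, h (y * x) * K x ∂μ ∂μ := by
  rw [lintegral_mul_lconv hF hF' hK hK' hh]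
  refine lintegral_congr fun y => ?_
  have := lintegral_mul_left_eq_self (μ := μ) (fun x => h (y * x) * K x) y⁻¹
  simp only [mul_inv_cancel_left] at this
  rw [this]

/-- Inversion reverses the order of a convolution, so this is the left version for the reflected
functions. -/
lemma lintegral_mul_lconv_right {F K h : G → ℝ≥0∞} (hF : AEMeasurable F μ)
    (hF' : ∫⁻ x, F x ∂μ ≠ ∞) (hK : AEMeasurable K μ) (hK' : ∫⁻ x, K x ∂μ ≠ ∞)
    (hh : AEMeasurable h μ) :
    ∫⁻ x, h x * ∫⁻ y, F y * K (y⁻¹ * x) ∂μ ∂μ = ∫⁻ y, K y * ∫⁻ x, h (x * y) * F x ∂μ ∂μ := by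
  have hinv := (Measure.measurePreserving_inv μ).quasiMeasurePreserving
  have key := lintegral_mul_lconv_left (hK.comp_quasiMeasurePreserving hinv)
    (by simpa only [Function.comp_apply, lintegral_inv_eq_self] using hK')
    (hF.comp_quasiMeasurePreserving hinv)
    (by simpa only [Function.comp_apply, lintegral_inv_eq_self] using hF')
    (hh.comp_quasiMeasurePreserving hinv)
  simp only [Function.comp_apply] at key
  rw [← lintegral_inv_eq_self] at key
  rw [← lintegral_inv_eq_self (f := fun y => K y⁻¹ * _)] at key
  refine Eq.trans (lintegral_congr fun x => ?_) (key.trans (lintegral_congr fun y => ?_))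
  · have := lintegral_mul_left_eq_self (μ := μ) (fun y => F y * K (y⁻¹ * x)) x
    rw [inv_inv, ← this]
    simp only [mul_inv_rev, inv_inv, inv_mul_cancel_right]
    congr 1
    refine lintegral_congr fun y => mul_comm _ _
  · rw [inv_inv, ← lintegral_inv_eq_self]
    simp only [mul_inv_rev, inv_inv]

section

variable {f g : G → ℂ}

/-- The truncated norms satisfy a product inequality of Leibniz type if the weight is
sub-additive. -/
lemma truncatedNorm_groupConv_le (hω : Measurable ω) {C : ℝ≥0} (hC : 1 ≤ C)
    (hωC : ∀ x y, ω (x * y) ≤ C * (ω x + ω y)) (hf : Integrable f μ) (hg : Integrable g μ)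
    (n : ℕ) :
    truncatedNorm Ψ ω μ n (groupConv μ f g) ≤
      C * (truncatedNorm Ψ ω μ n f * ∫⁻ x, ‖g x‖ₑ ∂μ +
        (∫⁻ x, ‖f x‖ₑ ∂μ) * truncatedNorm Ψ ω μ n g) := by
  let w : G → ℝ≥0∞ := fun x => min (ENNReal.ofReal (ω x)) n
  have hw : Measurable w := hω.ennreal_ofReal.min measurable_const
  -- Truncation at `n` keeps sub-additivity with the same constant because `C ≥ 1`: if either
  -- summand reaches `n`, the right side is already at least `n`.
  have hwC : ∀ x y, w x ≤ C * (w y + w (y⁻¹ * x)) := fun x y => by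
    have h1 : ENNReal.ofReal (ω x) ≤
        C * (ENNReal.ofReal (ω y) + ENNReal.ofReal (ω (y⁻¹ * x))) := by
      have := ENNReal.ofReal_le_ofReal (hωC y (y⁻¹ * x))
      rw [mul_inv_cancel_left, ENNReal.ofReal_mul C.coe_nonneg] at this
      refine this.trans ?_
      rw [ENNReal.ofReal_coe_nnreal]
      gcongr
      exact ENNReal.ofReal_add_le
    have hC' : (1 : ℝ≥0∞) ≤ C := by exact_mod_cast hC
    have hn : (n : ℝ≥0∞) ≤ C * n := le_mul_of_one_le_left' hC'
    simp only [w]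
    rcases le_total (ENNReal.ofReal (ω y)) n with h2 | h2
    · rcases le_total (ENNReal.ofReal (ω (y⁻¹ * x))) n with h3 | h3
      · rw [min_eq_left h2, min_eq_left h3]
        exact (min_le_left _ _).trans h1
      · rw [min_eq_right h3]
        exact (min_le_right _ _).trans (hn.trans (by gcongr; exact le_add_self))
    · rw [min_eq_right h2]
      exact (min_le_right _ _).trans (hn.trans (by gcongr; exact le_self_add))
  have hwi : ∀ {k : G → ℂ}, Integrable k μ → ∫⁻ x, w x * ‖k x‖ₑ ∂μ ≠ ∞ := fun hk =>
    ((lintegral_mono fun x => mul_le_mul_left (min_le_right _ _) _).trans_lt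
      ((lintegral_const_mul' _ _ (ENNReal.natCast_ne_top n)).trans_lt
        (ENNReal.mul_lt_top (ENNReal.natCast_lt_top n) hk.2))).ne
  have hwm : ∀ {k : G → ℂ}, Integrable k μ → AEMeasurable (fun x => w x * ‖k x‖ₑ) μ :=
    fun hk => hw.aemeasurable.mul hk.1.enorm
  refine truncatedNorm_le_iff.2 fun h hh hh1 => ?_
  let k : G → ℝ≥0∞ := fun x => min ‖h x‖ₑ n
  have hk : AEMeasurable k μ := hh.enorm.min aemeasurable_const
  have hpt : ∀ x, w x * ‖groupConv μ f g x‖ₑ ≤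
      C * (∫⁻ y, w y * ‖f y‖ₑ * ‖g (y⁻¹ * x)‖ₑ ∂μ +
        ∫⁻ y, ‖f y‖ₑ * (w (y⁻¹ * x) * ‖g (y⁻¹ * x)‖ₑ) ∂μ) := fun x => by
    have hgx : AEMeasurable (fun y => ‖g (y⁻¹ * x)‖ₑ) μ :=
      (hg.1.comp_quasiMeasurePreserving
        (measurePreserving_inv_mul_const x).quasiMeasurePreserving).enorm
    refine le_of_le_of_eq ?_ (congrArg _ (lintegral_add_left' ((hwm hf).mul hgx) _))
    rw [← lintegral_const_mul' _ _ ENNReal.coe_ne_top]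
    have hwx : w x ≠ ∞ := ((min_le_right _ _).trans_lt (ENNReal.natCast_lt_top n)).ne
    refine (mul_le_mul_right (enorm_groupConv_le f g x) _).trans ?_
    rw [← lintegral_const_mul' _ _ hwx]
    refine lintegral_mono fun y => ?_
    calc w x * (‖f y‖ₑ * ‖g (y⁻¹ * x)‖ₑ)
        ≤ C * (w y + w (y⁻¹ * x)) * (‖f y‖ₑ * ‖g (y⁻¹ * x)‖ₑ) := by gcongr; exact hwC x y
      _ = _ := by simp only [Pi.mul_apply]; ring
  have hF : AEMeasurable (fun x => k x * ∫⁻ y, w y * ‖f y‖ₑ * ‖g (y⁻¹ * x)‖ₑ ∂μ) μ :=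
    hk.mul (aemeasurable_lconv (hwm hf) (hwi hf) hg.1.enorm hg.2.ne)
  calc ∫⁻ x, k x * (w x * ‖groupConv μ f g x‖ₑ) ∂μ
      ≤ ∫⁻ x, C * (k x * ∫⁻ y, w y * ‖f y‖ₑ * ‖g (y⁻¹ * x)‖ₑ ∂μ +
        k x * ∫⁻ y, ‖f y‖ₑ * (w (y⁻¹ * x) * ‖g (y⁻¹ * x)‖ₑ) ∂μ) ∂μ := by
        refine lintegral_mono fun x => (mul_le_mul_right (hpt x) _).trans_eq ?_
        ring
    -- The weight sits on one factor in each term. The other factor becomes the outer variable, and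
    -- the translates of `h` stay admissible test functions by bi-invariance of `μ`.
    _ = C * (∫⁻ y, ‖g y‖ₑ * ∫⁻ x, k (x * y) * (w x * ‖f x‖ₑ) ∂μ ∂μ +
        ∫⁻ y, ‖f y‖ₑ * ∫⁻ x, k (y * x) * (w x * ‖g x‖ₑ) ∂μ ∂μ) := by
        rw [lintegral_const_mul' _ _ ENNReal.coe_ne_top, lintegral_add_left' hF,
          lintegral_mul_lconv_right (hwm hf) (hwi hf) hg.1.enorm hg.2.ne hk,
          lintegral_mul_lconv_left hf.1.enorm hf.2.ne (hwm hg) (hwi hg) hk]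
    _ ≤ _ := by
        rw [mul_comm (truncatedNorm Ψ ω μ n f), ← lintegral_mul_const'' _ hg.1.enorm,
          ← lintegral_mul_const'' _ hf.1.enorm]
        gcongr with y y
        · refine lintegral_le_truncatedNorm (g := fun x => h (x * y)) (hh.comp_quasiMeasurePreserving
            (measurePreserving_mul_right μ y).quasiMeasurePreserving) ?_
          rwa [lintegral_mul_right_eq_self (fun x => Ψ ‖h x‖)]
        · refine lintegral_le_truncatedNorm (g := fun x => h (y * x)) (hh.comp_quasiMeasurePreserving
            (measurePreserving_mul_left μ y).quasiMeasurePreserving) ?_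
          rwa [lintegral_mul_left_eq_self (fun x => Ψ ‖h x‖)]

/-- `L^Φ ∩ L¹` is stable under right convolution by `L¹`. -/
lemma MemOrlicz.conv (hΦ : IsYoungFunction Φ) (hf : MemOrlicz Φ μ f) (hfi : Integrable f μ)
    (hg : Integrable g μ) : MemOrlicz Φ μ (groupConv μ f g) := by
  obtain ⟨hfm, α₀, hα₀, hfin⟩ := hf
  set N : ℝ≥0∞ := ∫⁻ x, ‖g x‖ₑ ∂μ with hN
  have hNtop : N ≠ ∞ := hg.2.ne
  -- The factor `2 (N + 1)` leaves room to absorb the term `c N` produced below by the supporting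
  -- line.
  set α : ℝ := α₀ / (2 * (N.toReal + 1)) with hα
  have hαpos : 0 < α := by positivity
  have hα₀' : ENNReal.ofReal α₀ = ENNReal.ofReal α * (2 * (N + 1)) := by
    have : α₀ = α * (2 * (N.toReal + 1)) := by
      rw [hα, div_mul_cancel₀ _ (by positivity)]
    rw [this, ENNReal.ofReal_mul hαpos.le, ENNReal.ofReal_mul zero_le_two,
      ENNReal.ofReal_add ENNReal.toReal_nonneg zero_le_one, ENNReal.ofReal_toReal hNtop]
    simp
  have hFm := hΦ.comp_norm_aemeasurable hfm α₀
  refine ⟨(hfi.groupConv hg).1, α, hαpos, ?_⟩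
  -- A form of Jensen's inequality: `Φ(α |f * g|)` is dominated by the convolution of `Φ(α₀ |f|)`
  -- with `|g|`, whose integral is finite.
  refine lt_of_le_of_lt (lintegral_mono_ae
    (g := fun x => ∫⁻ y, Φ (α₀ * ‖f y‖) * ‖g (y⁻¹ * x)‖ₑ ∂μ) ?_) ?_
  · filter_upwards [ae_lt_top' (aemeasurable_lconv_enorm hfi hg)
      (lintegral_lconv_enorm_ne_top hfi hg)] with x hx
    set M := ∫⁻ y, ‖f y‖ₑ * ‖g (y⁻¹ * x)‖ₑ ∂μ with hM
    set J := ∫⁻ y, Φ (α₀ * ‖f y‖) * ‖g (y⁻¹ * x)‖ₑ ∂μ with hJ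
    set m := α * M.toReal with hm
    have hnorm : ‖groupConv μ f g x‖ ≤ M.toReal := by
      rw [← toReal_enorm]
      exact ENNReal.toReal_mono hx.ne (enorm_groupConv_le f g x)
    refine (hΦ.mono (by positivity) (y := m)
      (mul_le_mul_of_nonneg_left hnorm hαpos.le)).trans ?_
    rcases eq_or_ne M 0 with hM0 | hM0
    · simp [hm, hM0, hΦ.zero]
    -- `Φ m` may be infinite, so the bound is proved for every finite `c` below it. The
    -- supporting-line inequality is integrated against `|g (y⁻¹ * x)|` and then divided by `m = α
    -- M`.
    refine ENNReal.le_of_forall_nnreal_lt fun c hc => ?_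
    have hgx : AEMeasurable (fun y => ‖g (y⁻¹ * x)‖ₑ) μ :=
      (hg.1.comp_quasiMeasurePreserving
        (measurePreserving_inv_mul_const x).quasiMeasurePreserving).enorm
    have hgN : ∫⁻ y, ‖g (y⁻¹ * x)‖ₑ ∂μ = N := lintegral_enorm_inv_mul g x
    have hmM : ENNReal.ofReal m = ENNReal.ofReal α * M := by
      rw [hm, ENNReal.ofReal_mul hαpos.le, ENNReal.ofReal_toReal hx.ne]
    have hint : c * (ENNReal.ofReal α₀ * M) ≤ ENNReal.ofReal m * (J + c * N) := by
      calc c * (ENNReal.ofReal α₀ * M)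
          = ∫⁻ y, c * ENNReal.ofReal (α₀ * ‖f y‖) * ‖g (y⁻¹ * x)‖ₑ ∂μ := by
            rw [hM, ← lintegral_const_mul' _ _ ENNReal.ofReal_ne_top,
              ← lintegral_const_mul' _ _ ENNReal.coe_ne_top]
            refine lintegral_congr fun y => ?_
            rw [ENNReal.ofReal_mul hα₀.le, ofReal_norm]
            ring
        _ ≤ ∫⁻ y, ENNReal.ofReal m * (Φ (α₀ * ‖f y‖) * ‖g (y⁻¹ * x)‖ₑ +
              c * ‖g (y⁻¹ * x)‖ₑ) ∂μ := by
            refine lintegral_mono fun y => ?_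
            refine (mul_le_mul_left (hΦ.mul_le_add (by positivity)
              (mul_nonneg hα₀.le (norm_nonneg (f y))) hc.le) _).trans_eq ?_
            ring
        _ = _ := by
            rw [lintegral_const_mul' _ _ ENNReal.ofReal_ne_top, ← hgN,
              ← lintegral_const_mul' _ _ ENNReal.coe_ne_top]
            exact congrArg _ (lintegral_add_left' (hFm.mul hgx) _)
    have hm0 : ENNReal.ofReal m ≠ 0 := by
      rw [hmM]
      exact mul_ne_zero (by simpa using hαpos) hM0
    have h1 : (c : ℝ≥0∞) * (2 * (N + 1)) ≤ J + c * N := by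
      refine (ENNReal.mul_le_mul_iff_right hm0 ENNReal.ofReal_ne_top).1 (le_trans (le_of_eq ?_) hint)
      rw [hmM, hα₀']
      ring
    have h2 : (c : ℝ≥0∞) * (N + 1) + c * (N + 1) ≤ J + c * (N + 1) := by
      calc (c : ℝ≥0∞) * (N + 1) + c * (N + 1) = c * (2 * (N + 1)) := by ring
        _ ≤ J + c * N := h1
        _ ≤ _ := by gcongr; exact le_self_add
    have h3 := ENNReal.le_of_add_le_add_right
      (ENNReal.mul_ne_top ENNReal.coe_ne_top (ENNReal.add_ne_top.2 ⟨hNtop, ENNReal.one_ne_top⟩)) h2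
    exact (le_mul_of_one_le_right' le_add_self).trans h3
  · rw [lintegral_lconv hFm hfin.ne hg.1.enorm hg.2.ne]
    exact ENNReal.mul_lt_top hfin hg.2

end

end Convolution

/-! ### Convolution identities and discreteness -/

section Convolution

variable {G : Type*} [Group G] [TopologicalSpace G] [IsTopologicalGroup G]
  [MeasurableSpace G] [BorelSpace G]
  {μ : Measure G}

section Sub

variable [LocallyCompactSpace G] [T2Space G] [NormalSpace G] [μ.IsMulLeftInvariant]
  [μ.IsMulRightInvariant] [μ.IsInvInvariant] [μ.Regular] {f g h : G → ℂ}

lemma groupConv_sub_left (hf : Integrable f μ) (hg : Integrable g μ) (hh : Integrable h μ) :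
    groupConv μ (f - g) h =ᵐ[μ] groupConv μ f h - groupConv μ g h := by
  have := groupConv_add_left hf (hg.smul (-1 : ℂ)) hh
  rwa [groupConv_smul_left, neg_one_smul, neg_one_smul, ← sub_eq_add_neg, ← sub_eq_add_neg] at this

lemma groupConv_sub_right (hf : Integrable f μ) (hg : Integrable g μ) (hh : Integrable h μ) :
    groupConv μ f (g - h) =ᵐ[μ] groupConv μ f g - groupConv μ f h := by
  have := groupConv_add_right hf hg (hh.smul (-1 : ℂ))
  rwa [groupConv_smul_right, neg_one_smul, neg_one_smul, ← sub_eq_add_neg, ← sub_eq_add_neg] at this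

end Sub

/-- If a space of integrable functions that contains the indicator functions of compact sets has a
convolution identity, then the group is discrete. -/
lemma IsConvIdentity.isOpen_singleton_one [LocallyCompactSpace G] [T2Space G] [μ.IsHaarMeasure]
    [μ.Regular] {A : Set (G → ℂ)} {e : G → ℂ} (he : IsConvIdentity μ A e)
    (hA : ∀ f ∈ A, Integrable f μ) (hAK : ∀ K, IsCompact K → ∀ c : ℂ, K.indicator (fun _ => c) ∈ A) :
    IsOpen {(1 : G)} := by
  rw [isOpen_singleton_iff_punctured_nhds]
  by_contra hne
  have : (𝓝[≠] (1 : G)).NeBot := ⟨hne⟩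
  -- Absolute continuity of the integral of `e`. If `1` is not isolated, singletons are null, so `1`
  -- has an open neighbourhood `V` with `∫_V |e| < 1`.
  obtain ⟨δ, hδ, hδe⟩ := exists_pos_setLIntegral_lt_of_measure_lt (hA e he.1).2.ne one_ne_zero
  obtain ⟨V, h1V, hVo, hVδ⟩ := Set.exists_isOpen_lt_of_lt (μ := μ) {(1 : G)} δ
    (by simpa using hδ)
  obtain ⟨W, hW, hWV⟩ := exists_nhds_split_inv (hVo.mem_nhds (h1V rfl))
  obtain ⟨U, hU, hUW, hUc⟩ := local_compact_nhds hW
  have hconv := (he.2 _ (hAK U hUc 1)).1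
  have hμU : μ U ≠ 0 := (μ.measure_pos_of_mem_nhds hU).ne'
  refine hμU (measure_mono_null (fun x hx => ?_) hconv)
  intro hx'
  change groupConv μ e _ x = _ at hx'
  rw [Set.indicator_of_mem hx] at hx'
  -- For `x ∈ U` the integrand lives on `U U⁻¹ ⊆ V`, so `e * 1_U` stays below `1` on `U`, a set of
  -- positive measure on which an identity would reproduce the value `1`.
  have hlt : ‖groupConv μ e (U.indicator fun _ => 1) x‖ₑ < 1 := by
    refine lt_of_le_of_lt ((enorm_groupConv_le _ _ x).trans ?_) (hδe V hVδ)
    rw [← lintegral_indicator hVo.measurableSet]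
    refine lintegral_mono fun y => ?_
    by_cases hy : y⁻¹ * x ∈ U
    · have hyV : y ∈ V := by
        have := hWV x (hUW hx) _ (hUW hy)
        simpa using this
      simp [hy, hyV]
    · simp [hy]
  rw [hx'] at hlt
  simp at hlt

/-- On a discrete group the normalized indicator function of the identity element is a convolution
identity. -/
lemma isConvIdentity_indicator_one [T2Space G] [μ.IsHaarMeasure] (h1 : IsOpen {(1 : G)})
    {A : Set (G → ℂ)} (hA : Set.indicator {(1 : G)} (fun _ => ((μ.real {(1 : G)})⁻¹ : ℂ)) ∈ A) :
    IsConvIdentity μ A (Set.indicator {(1 : G)} fun _ => ((μ.real {(1 : G)})⁻¹ : ℂ)) := by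
  have hpos : (μ.real {(1 : G)} : ℂ) ≠ 0 := by
    rw [Complex.ofReal_ne_zero, measureReal_ne_zero_iff isCompact_singleton.measure_lt_top.ne]
    exact (h1.measure_pos μ (Set.singleton_nonempty 1)).ne'
  refine ⟨hA, fun f _ => ⟨.of_forall fun x => ?_, .of_forall fun x => ?_⟩⟩
  · have : (fun y : G => Set.indicator {(1 : G)} (fun _ => ((μ.real {(1 : G)})⁻¹ : ℂ)) y *
        f (y⁻¹ * x)) = Set.indicator {(1 : G)}
          (fun y => ((μ.real {(1 : G)})⁻¹ : ℂ) * f (y⁻¹ * x)) := by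
      ext y
      by_cases hy : y = 1 <;> simp [hy]
    rw [groupConv, this, integral_indicator (measurableSet_singleton _), integral_singleton]
    simp [hpos]
  · have : (fun y : G => f y * Set.indicator {(1 : G)} (fun _ => ((μ.real {(1 : G)})⁻¹ : ℂ))
        (y⁻¹ * x)) = Set.indicator {x} (fun y => f y * ((μ.real {(1 : G)})⁻¹ : ℂ)) := by
      ext y
      by_cases hy : y = x
      · simp [hy]
      · have : ¬ y⁻¹ * x = 1 := fun h => hy (inv_mul_eq_one.1 h)
        simp [hy, this]
    have hx : μ.real {x} = μ.real {(1 : G)} := congrArg ENNReal.toReal (Measure.haar_singleton μ x)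
    rw [groupConv, this, integral_indicator (measurableSet_singleton _), integral_singleton, hx]
    rw [Complex.real_smul, mul_comm (f x), mul_inv_cancel_left₀ hpos]

/-- The identity elements of different convolution algebras of integrable functions agree. -/
lemma IsConvIdentity.of_isConvIdentity [μ.IsMulRightInvariant] [μ.IsInvInvariant]
    [LocallyCompactSpace G] [T2Space G] [μ.IsHaarMeasure]
    [μ.Regular] {A B : Set (G → ℂ)} {e : G → ℂ} (he : IsConvIdentity μ A e)
    (hA : ∀ f ∈ A, Integrable f μ) (hAK : ∀ K, IsCompact K → ∀ c : ℂ, K.indicator (fun _ => c) ∈ A)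
    (hBK : ∀ K, IsCompact K → ∀ c : ℂ, K.indicator (fun _ => c) ∈ B)
    (hB : ∀ f g : G → ℂ, f ∈ B → f =ᵐ[μ] g → g ∈ B) : IsConvIdentity μ B e := by
  -- The group is discrete, so the normalized point mass is an identity of both algebras. Uniqueness
  -- of the identity in `A` makes it equal to `e` almost everywhere.
  have h1 := he.isOpen_singleton_one hA hAK
  have hA1 := isConvIdentity_indicator_one (μ := μ) h1 (hAK _ isCompact_singleton _)
  have hB1 := isConvIdentity_indicator_one (μ := μ) h1 (hBK _ isCompact_singleton _)
  have hee := (he.2 _ hA1.1).1.symm.trans (hA1.2 _ he.1).2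
  refine ⟨hB _ _ hB1.1 hee, fun f hf => ?_⟩
  rw [← groupConv_congr hee (ae_eq_refl f), ← groupConv_congr (ae_eq_refl f) hee]
  exact hB1.2 f hf

end Convolution

/-! ### Inverse-closedness in `L¹` and equality of spectra -/

section Weighted

variable {G : Type*} [Group G] [TopologicalSpace G]
  [MeasurableSpace G] [BorelSpace G] [T2Space G] {μ : Measure G} {Φ Ψ : ℝ → ℝ≥0∞} {ω : G → ℝ}

lemma IsWeight.mem_weightedOrliczSpace [IsFiniteMeasureOnCompacts μ] (hω : IsWeight ω)
    (hΦΨ : IsComplementaryPair Φ Ψ) {f : G → ℂ}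
    {K : Set G} (hK : IsCompact K) {M : ℝ} (hf : AEStronglyMeasurable f μ) (hfM : ∀ x, ‖f x‖ ≤ M)
    (hfK : ∀ x ∉ K, f x = 0) : f ∈ weightedOrliczSpace Φ Ψ ω μ := by
  obtain ⟨B, hB⟩ := hω.bounded_on_compact K hK
  exact mem_weightedOrliczSpace_of_bounded hΦΨ hω.one_le hK.measurableSet hK.measure_lt_top.ne
    (fun x hx => hB (Set.mem_image_of_mem ω hx)) hf hfM hfK

lemma IsWeight.continuous_mem_weightedOrliczSpace [IsFiniteMeasureOnCompacts μ] (hω : IsWeight ω)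
    (hΦΨ : IsComplementaryPair Φ Ψ) {f : G → ℂ} (hf : Continuous f) (hfs : HasCompactSupport f) :
    f ∈ weightedOrliczSpace Φ Ψ ω μ := by
  obtain ⟨M, hM⟩ := hfs.exists_bound_of_continuous hf
  exact hω.mem_weightedOrliczSpace hΦΨ hfs.isCompact
    (hf.stronglyMeasurable_of_hasCompactSupport hfs).aestronglyMeasurable hM
    fun x hx => image_eq_zero_of_notMem_tsupport hx

lemma IsWeight.indicator_mem_weightedOrliczSpace [IsFiniteMeasureOnCompacts μ] (hω : IsWeight ω)
    (hΦΨ : IsComplementaryPair Φ Ψ) {K : Set G} (hK : IsCompact K) (c : ℂ) :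
    K.indicator (fun _ => c) ∈ weightedOrliczSpace Φ Ψ ω μ :=
  hω.mem_weightedOrliczSpace hΦΨ hK (M := ‖c‖)
    ((stronglyMeasurable_const.indicator hK.measurableSet).aestronglyMeasurable)
    (fun x => norm_indicator_le_norm_self (fun _ => c) x) fun _ hx => Set.indicator_of_notMem hx _

variable [IsTopologicalGroup G] [μ.IsMulRightInvariant] [μ.IsInvInvariant] [LocallyCompactSpace G]
  [NormalSpace G] [μ.IsHaarMeasure] [μ.Regular]

/-- For a sub-additive weight, quasi-inverses in `L¹` of elements of `L^Φ(G, ω)` belong to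
`L^Φ(G, ω)`. -/
lemma IsLPhiWeight.mem_of_quasiInverse (hω : IsLPhiWeight Φ Ψ ω μ)
    (hΦΨ : IsComplementaryPair Φ Ψ) (hinv : MemOrlicz Ψ μ (fun x => 1 / ω x))
    (hsub : IsSubadditiveWeight ω) {a b : G → ℂ} (ha : a ∈ weightedOrliczSpace Φ Ψ ω μ)
    (hb : Integrable b μ) (hab : groupConv μ a b =ᵐ[μ] a + b)
    (hba : groupConv μ b a =ᵐ[μ] a + b) : b ∈ weightedOrliczSpace Φ Ψ ω μ := by
  have hωm := hω.weight.measurable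
  have hΦ := hΦΨ.left
  have hint : ∀ {f}, f ∈ weightedOrliczSpace Φ Ψ ω μ → Integrable f μ := fun hf =>
    weightedOrliczSpace_subset_integrable hΦΨ.right hω.weight.one_le hinv hf
  have hai := hint ha
  obtain ⟨C, hC, hωC⟩ : ∃ C : ℝ≥0, 1 ≤ C ∧ ∀ x y, ω (x * y) ≤ C * (ω x + ω y) := by
    obtain ⟨C, -, hC⟩ := hsub
    refine ⟨max 1 C.toNNReal, le_max_left _ _, fun x y => (hC x y).trans ?_⟩
    have h1 := hω.weight.one_le x
    have h2 := hω.weight.one_le y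
    have h3 : C ≤ ((max 1 C.toNNReal : ℝ≥0) : ℝ) :=
      (Real.le_coe_toNNReal C).trans (by exact_mod_cast le_max_right _ _)
    exact mul_le_mul_of_nonneg_right h3 (by linarith)
  set Na := ∫⁻ x, ‖a x‖ₑ ∂μ
  have hNa : Na ≠ ∞ := hai.2.ne
  have hCtop : (2 * C * (1 + Na) : ℝ≥0∞) ≠ ∞ :=
    ENNReal.mul_ne_top (ENNReal.mul_ne_top ENNReal.ofNat_ne_top ENNReal.coe_ne_top)
      (ENNReal.add_ne_top.2 ⟨ENNReal.one_ne_top, hNa⟩)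
  -- The precision is chosen so that `u` below, which equals `a * (b - p) - (b - p)`, satisfies `C
  -- ‖u‖₁ ≤ C (1 + ‖a‖₁) ‖b - p‖₁ ≤ 1/2`.
  obtain ⟨p, hps, hpb, hpc, hpi⟩ := hb.exists_hasCompactSupport_lintegral_sub_le
    (ENNReal.inv_ne_zero.2 hCtop)
  have hp : p ∈ weightedOrliczSpace Φ Ψ ω μ :=
    hω.weight.continuous_mem_weightedOrliczSpace hΦΨ hpc hps
  set u := a + p - groupConv μ a p with hu
  have huA : u ∈ weightedOrliczSpace Φ Ψ ω μ :=
    weightedOrliczSpace_sub hΦ hωm (weightedOrliczSpace_add hΦ hωm ha hp) (hω.conv_mem a ha p hp)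
  have hui := hint huA
  have hpuA := weightedOrliczSpace_sub hΦ hωm hp huA
  have hu1 : (C : ℝ≥0∞) * ∫⁻ x, ‖u x‖ₑ ∂μ ≤ 2⁻¹ := by
    have hbp := hb.sub hpi
    have e : u =ᵐ[μ] groupConv μ a (b - p) - (b - p) := by
      filter_upwards [groupConv_sub_right hai hb hpi, hab] with x h1 h2
      simp only [hu, Pi.sub_apply, Pi.add_apply] at h1 h2 ⊢
      rw [h1, h2]
      ring
    calc (C : ℝ≥0∞) * ∫⁻ x, ‖u x‖ₑ ∂μ
        ≤ C * ∫⁻ x, (‖groupConv μ a (b - p) x‖ₑ + ‖(b - p) x‖ₑ) ∂μ := by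
          refine mul_le_mul_right (lintegral_mono_ae ?_) _
          filter_upwards [e] with x hx
          rw [hx]
          exact enorm_sub_le
      _ ≤ C * (Na * ∫⁻ x, ‖(b - p) x‖ₑ ∂μ + ∫⁻ x, ‖(b - p) x‖ₑ ∂μ) := by
          rw [lintegral_add_right' _ hbp.1.enorm]
          gcongr
          exact lintegral_enorm_groupConv_le hai hbp
      _ = C * (1 + Na) * ∫⁻ x, ‖(b - p) x‖ₑ ∂μ := by ring
      _ ≤ C * (1 + Na) * (2 * C * (1 + Na))⁻¹ := by gcongr; exact hpb
      _ = 2⁻¹ := by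
          have h0 : (C * (1 + Na) : ℝ≥0∞) ≠ 0 := mul_ne_zero
            (by exact_mod_cast (zero_lt_one.trans_le hC).ne') (by simp)
          have ht : (C * (1 + Na) : ℝ≥0∞) ≠ ∞ :=
            ENNReal.mul_ne_top ENNReal.coe_ne_top (ENNReal.add_ne_top.2 ⟨ENNReal.one_ne_top, hNa⟩)
          rw [mul_assoc 2, ENNReal.mul_inv (Or.inr ht) (Or.inr h0), mul_left_comm,
            ENNReal.mul_inv_cancel h0 ht, mul_one]
  -- This is `(1 - b)(1 - u) = (1 - b)(1 - a)(1 - p) = 1 - p`, written without a unit.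
  have hbu : b =ᵐ[μ] (p - u) + groupConv μ b u := by
    have hapi := hai.groupConv hpi
    have e1 := groupConv_sub_right hb (hai.add hpi) hapi
    have e2 := groupConv_add_right hb hai hpi
    have e3 := groupConv_assoc hb hai hpi
    rw [groupConv_congr hba (ae_eq_refl p)] at e3
    have e4 := groupConv_add_left hai hb hpi
    filter_upwards [e1, e2, e3, e4, hba] with x h1 h2 h3 h4 h5
    simp only [hu, Pi.sub_apply, Pi.add_apply] at h1 h2 h3 h4 h5 ⊢
    rw [h1, h2, ← h3, h4, h5]
    ring
  set Nb := ∫⁻ x, ‖b x‖ₑ ∂μ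
  set B := weightedOrliczNorm Ψ ω μ (p - u) + C * (Nb * weightedOrliczNorm Ψ ω μ u) with hB
  have hBtop : 2 * B < ∞ := ENNReal.mul_lt_top ENNReal.ofNat_lt_top (ENNReal.add_lt_top.2
    ⟨hpuA.2, ENNReal.mul_lt_top ENNReal.coe_lt_top (ENNReal.mul_lt_top hb.2 huA.2)⟩)
  have hbound : ∀ n, truncatedNorm Ψ ω μ n b ≤ 2 * B := fun n => by
    have hT := truncatedNorm_ne_top (Ψ := Ψ) (ω := ω) (n := n) hb
    set T := truncatedNorm Ψ ω μ n b with hTdef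
    -- The Leibniz inequality bounds the `b * u` term by `T / 2` plus a constant independent of `n`;
    -- since `T` is finite, half of it can be cancelled.
    have h1 : T ≤ B + 2⁻¹ * T := by
      calc T = truncatedNorm Ψ ω μ n ((p - u) + groupConv μ b u) := truncatedNorm_congr hbu
        _ ≤ truncatedNorm Ψ ω μ n (p - u) + truncatedNorm Ψ ω μ n (groupConv μ b u) :=
          truncatedNorm_add_le hωm hpuA.1.1
        _ ≤ weightedOrliczNorm Ψ ω μ (p - u) +
            C * (T * (∫⁻ x, ‖u x‖ₑ ∂μ) + Nb * weightedOrliczNorm Ψ ω μ u) := by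
          refine add_le_add (truncatedNorm_le_weightedOrliczNorm hω.weight.one_le)
            ((truncatedNorm_groupConv_le hωm hC hωC hb hui n).trans ?_)
          gcongr
          exact truncatedNorm_le_weightedOrliczNorm hω.weight.one_le
        _ = B + (C * ∫⁻ x, ‖u x‖ₑ ∂μ) * T := by rw [hB]; ring
        _ ≤ _ := by gcongr
    have h2 : 2⁻¹ * T ≠ ∞ := ENNReal.mul_ne_top (by simp) hT
    have h3 : 2⁻¹ * T + 2⁻¹ * T ≤ B + 2⁻¹ * T := by
      rwa [← add_mul, ENNReal.inv_two_add_inv_two, one_mul]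
    have h4 := ENNReal.le_of_add_le_add_right h2 h3
    calc T = 2 * (2⁻¹ * T) := by
          rw [← mul_assoc, ENNReal.mul_inv_cancel two_ne_zero ENNReal.ofNat_ne_top, one_mul]
      _ ≤ 2 * B := by gcongr
  refine ⟨?_, (weightedOrliczNorm_le_of_truncatedNorm_le hω.weight.one_le hωm hb.1
    hbound).trans_lt hBtop⟩
  -- Finiteness of the weighted norm is only half of membership. The `Φ`-integrability comes from `b
  -- = a * b - a`, both terms of which lie in `L^Φ`.
  refine ((ha.1.conv hΦ hai hb).add hΦ (ha.1.const_smul hΦ (-1))).congr ?_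
  filter_upwards [hab] with x hx
  simp only [Pi.add_apply, Pi.smul_apply] at hx ⊢
  rw [hx]
  simp

-- Ensures that both spectra are computed in the same way, either with a common identity or in the
-- unitizations. Either algebra consists of integrable functions and contains the indicators of
-- compact sets, so identities transfer both ways.
omit [NormalSpace G] in
lemma IsLPhiWeight.isConvIdentity_iff (hω : IsLPhiWeight Φ Ψ ω μ)
    (hΦΨ : IsComplementaryPair Φ Ψ) (hinv : MemOrlicz Ψ μ (fun x => 1 / ω x)) (e : G → ℂ) :
    IsConvIdentity μ (weightedOrliczSpace Φ Ψ ω μ) e ↔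
      IsConvIdentity μ (integrableFunctions μ) e := by
  have h1 : ∀ K : Set G, IsCompact K → ∀ c : ℂ,
      K.indicator (fun _ => c) ∈ integrableFunctions μ := fun K hK c =>
    (integrable_indicator_iff hK.measurableSet).2 (integrableOn_const hK.measure_lt_top.ne)
  have h2 : ∀ K : Set G, IsCompact K → ∀ c : ℂ,
      K.indicator (fun _ => c) ∈ weightedOrliczSpace Φ Ψ ω μ := fun K hK c =>
    hω.weight.indicator_mem_weightedOrliczSpace hΦΨ hK c
  refine ⟨fun h => h.of_isConvIdentity (fun f hf => ?_) h2 h1 fun f g hf hfg => ?_,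
    fun h => h.of_isConvIdentity (fun f hf => hf) h1 h2 fun f g hf hfg => ?_⟩
  · exact weightedOrliczSpace_subset_integrable hΦΨ.right hω.weight.one_le hinv hf
  · exact Integrable.congr hf hfg
  · exact weightedOrliczSpace_congr hf hfg

/-- For a sub-additive weight the spectra in `L^Φ(G, ω)` and in `L¹(G)` agree. -/
lemma IsLPhiWeight.convSpectrum_eq (hω : IsLPhiWeight Φ Ψ ω μ)
    (hΦΨ : IsComplementaryPair Φ Ψ) (hinv : MemOrlicz Ψ μ (fun x => 1 / ω x))
    (hsub : IsSubadditiveWeight ω) {f : G → ℂ} (hf : f ∈ weightedOrliczSpace Φ Ψ ω μ) :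
    convSpectrum μ (weightedOrliczSpace Φ Ψ ω μ) f = convSpectrum μ (integrableFunctions μ) f := by
  have hωm := hω.weight.measurable
  have hΦ := hΦΨ.left
  have hint : ∀ {f}, f ∈ weightedOrliczSpace Φ Ψ ω μ → Integrable f μ := fun hf =>
    weightedOrliczSpace_subset_integrable hΦΨ.right hω.weight.one_le hinv hf
  ext z
  refine not_congr ?_
  simp only [IsConvInvertible, hω.isConvIdentity_iff hΦΨ hinv]
  refine or_congr (exists_congr fun e => and_congr_right fun he => exists_congr fun g => ?_)
    (and_congr_right fun _ => exists_congr fun c => exists_congr fun g => ?_)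
  · refine ⟨fun ⟨hg, h⟩ => ⟨hint hg, h⟩, fun ⟨hg, h1, h2⟩ => ⟨?_, h1, h2⟩⟩
    have heA := ((hω.isConvIdentity_iff hΦΨ hinv e).2 he).1
    have hei := hint heA
    have hpA := weightedOrliczSpace_sub hΦ hωm hf (weightedOrliczSpace_const_smul hΦ z heA)
    have hpi := hint hpA
    set p := f - z • e
    have hg' : Integrable g μ := hg
    -- `p` and `g` are mutually inverse exactly when `e - p` and `e - g` are quasi-inverse.
    have key := hω.mem_of_quasiInverse hΦΨ hinv hsub (a := e - p) (b := e - g)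
      (weightedOrliczSpace_sub hΦ hωm heA hpA) (hei.sub hg') ?_ ?_
    · have := weightedOrliczSpace_sub hΦ hωm heA key
      rwa [sub_sub_cancel] at this
    · filter_upwards [groupConv_sub_left hei hpi (hei.sub hg'), groupConv_sub_right hpi hei hg',
        (he.2 p hpi).2, h1, (he.2 _ (hei.sub hg')).1] with x h3 h4 h5 h6 h7
      simp only [Pi.sub_apply, Pi.add_apply] at h3 h4 h5 h6 h7 ⊢
      rw [h3, h4, h5, h6, h7]
      ring
    · filter_upwards [groupConv_sub_left hei hg' (hei.sub hpi), groupConv_sub_right hg' hei hpi,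
        (he.2 g hg').2, h2, (he.2 _ (hei.sub hpi)).1] with x h3 h4 h5 h6 h7
      simp only [Pi.sub_apply, Pi.add_apply] at h3 h4 h5 h6 h7 ⊢
      rw [h3, h4, h5, h6, h7]
      ring
  · refine ⟨fun ⟨hg, h⟩ => ⟨hint hg, h⟩, fun ⟨hg, h1, h2⟩ => ⟨?_, h1, h2⟩⟩
    obtain ⟨hzc, h1⟩ := h1
    obtain ⟨-, h2⟩ := h2
    simp only [unitizationMul] at hzc h1 h2
    have hz : z ≠ 0 := by
      rintro rfl
      simp at hzc
    -- The scalar component fixes `c`, and `(-z + f)(-z⁻¹ + g) = (1 - z⁻¹ f)(1 - z g)` exhibits the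
    -- quasi-inverse pair `z⁻¹ f`, `z g`.
    have hc : c = -z⁻¹ := by
      field_simp
      linear_combination -hzc
    have hg' : Integrable g μ := hg
    have key := hω.mem_of_quasiInverse hΦΨ hinv hsub (a := z⁻¹ • f) (b := z • g)
      (weightedOrliczSpace_const_smul hΦ _ hf) (hg'.smul z) ?_ ?_
    · have := weightedOrliczSpace_const_smul hΦ z⁻¹ key
      rwa [inv_smul_smul₀ hz] at this
    · rw [groupConv_smul_left, groupConv_smul_right, inv_smul_smul₀ hz]
      filter_upwards [h1] with x h3
      simp only [Pi.add_apply, Pi.smul_apply, smul_eq_mul, hc, Pi.zero_apply] at h3 ⊢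
      linear_combination h3
    · rw [groupConv_smul_left, groupConv_smul_right, smul_inv_smul₀ hz]
      filter_upwards [h2] with x h3
      simp only [Pi.add_apply, Pi.smul_apply, smul_eq_mul, hc, Pi.zero_apply] at h3 ⊢
      linear_combination h3

end Weighted

/-! ### Self-adjoint convolution operators and their resolvents -/

section Pointwise

variable {G : Type*} [Group G] [MeasurableSpace G] {μ : Measure G} {H : Subgroup G} {f g : G → ℂ}

lemma groupConv_eq_zero_of_notMem (hf : ∀ x ∉ H, f x = 0) (hg : ∀ x ∉ H, g x = 0) {x : G}
    (hx : x ∉ H) : groupConv μ f g x = 0 := by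
  have : ∀ y, f y * g (y⁻¹ * x) = 0 := fun y => by
    by_cases hy : y ∈ H
    · rw [hg _ fun h => hx ((H.mul_mem_cancel_left (H.inv_mem hy)).1 h), mul_zero]
    · rw [hf y hy, zero_mul]
  simp [groupConv, this]

end Pointwise

section SelfAdjoint

variable {G : Type*} [Group G] [TopologicalSpace G] [IsTopologicalGroup G]
  [MeasurableSpace G] [BorelSpace G] {μ : Measure G}
  [μ.IsMulRightInvariant] [μ.IsInvInvariant] {f g u v : G → ℂ}

lemma lconv_enorm_le_of_bound_left {M : ℝ} (hf : ∀ x, ‖f x‖ ≤ M) (x : G) :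
    ∫⁻ y, ‖f y‖ₑ * ‖g (y⁻¹ * x)‖ₑ ∂μ ≤ ENNReal.ofReal M * ∫⁻ y, ‖g y‖ₑ ∂μ := by
  rw [← lintegral_enorm_inv_mul g x, ← lintegral_const_mul' _ _ ENNReal.ofReal_ne_top]
  refine lintegral_mono fun y => mul_le_mul_left ?_ _
  rw [← ofReal_norm]
  exact ENNReal.ofReal_le_ofReal (hf y)

lemma norm_groupConv_le_of_bound_left {M : ℝ} (hf : ∀ x, ‖f x‖ ≤ M) (hg : Integrable g μ) (x : G) :
    ‖groupConv μ f g x‖ ≤ (ENNReal.ofReal M * ∫⁻ y, ‖g y‖ₑ ∂μ).toReal := by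
  rw [← toReal_enorm]
  exact ENNReal.toReal_mono (ENNReal.mul_ne_top ENNReal.ofReal_ne_top hg.2.ne)
    ((enorm_groupConv_le f g x).trans (lconv_enorm_le_of_bound_left hf x))

omit [TopologicalSpace G] [IsTopologicalGroup G] [BorelSpace G]
  [μ.IsMulRightInvariant] [μ.IsInvInvariant] in
lemma norm_groupConv_le_of_bound_right {M : ℝ} (hf : ∀ x, ‖f x‖ ≤ M) (hg : Integrable g μ) (x : G) :
    ‖groupConv μ g f x‖ ≤ (ENNReal.ofReal M * ∫⁻ y, ‖g y‖ₑ ∂μ).toReal := by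
  rw [← toReal_enorm]
  refine ENNReal.toReal_mono (ENNReal.mul_ne_top ENNReal.ofReal_ne_top hg.2.ne)
    ((enorm_groupConv_le g f x).trans ?_)
  rw [← lintegral_const_mul' _ _ ENNReal.ofReal_ne_top]
  refine lintegral_mono fun y => ?_
  rw [mul_comm, ← ofReal_norm (f _)]
  gcongr
  exact hf _

variable [LocallyCompactSpace G] [T2Space G] [NormalSpace G] [μ.IsMulLeftInvariant] [μ.Regular]

/-- Boundedness of `f` makes `|f| * |u|` bounded, so the double integral against `v ∈ L¹` converges
absolutely. -/
lemma integral_groupConv_mul (hf : Integrable f μ) {M : ℝ} (hfM : ∀ x, ‖f x‖ ≤ M)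
    (hu : Integrable u μ) (hv : Integrable v μ) :
    ∫ x, groupConv μ f u x * v x ∂μ = ∫ y, f y * ∫ x, u (y⁻¹ * x) * v x ∂μ ∂μ := by
  refine (aestronglyMeasurable_groupConv_and_integral_mul hf hu).2 v hv.1 ?_
  have := lintegral_mul_lconv hf.1.enorm hf.2.ne hu.1.enorm hu.2.ne hv.1.enorm
  simp_rw [mul_comm ‖u _‖ₑ, ← this]
  refine (lintegral_mono fun x => mul_le_mul_right (lconv_enorm_le_of_bound_left hfM x) _).trans_lt ?_
  have hM : ENNReal.ofReal M * ∫⁻ y, ‖u y‖ₑ ∂μ ≠ ∞ :=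
    ENNReal.mul_ne_top ENNReal.ofReal_ne_top hu.2.ne
  rw [lintegral_mul_const' _ _ hM]
  exact ENNReal.mul_lt_top hv.2 hM.lt_top

/-- Convolution by a self-adjoint function is a symmetric operator. -/
lemma integral_groupConv_mul_conj (hf : Integrable f μ) {M : ℝ} (hfM : ∀ x, ‖f x‖ ≤ M)
    (hstar : groupStar f =ᵐ[μ] f) (hu : Integrable u μ) (hv : Integrable v μ) :
    ∫ x, groupConv μ f u x * (starRingEnd ℂ) (v x) ∂μ =
      ∫ x, u x * (starRingEnd ℂ) (groupConv μ f v x) ∂μ := by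
  have hconj : ∀ {k : G → ℂ}, Integrable k μ → Integrable (fun x => (starRingEnd ℂ) (k x)) μ :=
    fun hk => (Complex.conjLIE.toContinuousLinearEquiv.integrable_comp_iff).2 hk
  have h1 := integral_groupConv_mul hf hfM hu (hconj hv)
  have h2 := integral_groupConv_mul hf hfM hv (hconj hu)
  have h3 : ∫ x, u x * (starRingEnd ℂ) (groupConv μ f v x) ∂μ =
      (starRingEnd ℂ) (∫ x, groupConv μ f v x * (starRingEnd ℂ) (u x) ∂μ) := by
    rw [← integral_conj]
    refine integral_congr_ae (.of_forall fun x => ?_)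
    simp [mul_comm]
  -- Substituting `y⁻¹` for `y` in the outer integral brings in `f (y⁻¹)`, whose conjugate is `f y`
  -- almost everywhere; the inner integrals then differ by a translation.
  rw [h1, h3, h2, ← integral_conj, ← integral_inv_eq_self _ μ]
  refine integral_congr_ae ?_
  filter_upwards [(Measure.measurePreserving_inv μ).quasiMeasurePreserving.ae_eq_comp hstar]
    with y hy
  simp only [groupStar, Function.comp_apply, inv_inv] at hy
  rw [map_mul, ← integral_conj, ← hy]
  congr 1
  have := integral_mul_left_eq_self (μ := μ)
    (fun x => u (y * x) * (starRingEnd ℂ) (v x)) y⁻¹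
  simp only [mul_inv_cancel_left] at this
  rw [inv_inv]
  rw [← integral_mul_left_eq_self (μ := μ)
    (fun x => (starRingEnd ℂ) (v (y⁻¹ * x) * (starRingEnd ℂ) (u x))) y]
  simp only [inv_mul_cancel_left, map_mul, Complex.conj_conj, mul_comm]

end SelfAdjoint

section Resolvent

variable {G : Type*} [Group G] [TopologicalSpace G] [IsTopologicalGroup G]
  [MeasurableSpace G] [BorelSpace G] {μ : Measure G}
  [μ.IsMulRightInvariant] [μ.IsInvInvariant] {f : G → ℂ}
  [LocallyCompactSpace G] [T2Space G] [NormalSpace G] [μ.IsMulLeftInvariant] [μ.Regular]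

/-- Convolution by a bounded self-adjoint function on the Hilbert space `L²(H)` of a compact
set `H`. -/
lemma exists_isSymmetric_groupConv {H : Set G} (hH : IsCompact H) (hf : Integrable f μ)
    {M : ℝ} (hfM : ∀ x, ‖f x‖ ≤ M) (hstar : groupStar f =ᵐ[μ] f) :
    ∃ T : Lp ℂ 2 (μ.restrict H) →ₗ[ℂ] Lp ℂ 2 (μ.restrict H), T.IsSymmetric ∧
      ∀ u, T u =ᵐ[μ.restrict H] groupConv μ f (H.indicator u) := by
  have : IsFiniteMeasure (μ.restrict H) := isFiniteMeasure_restrict.2 hH.measure_lt_top.ne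
  have hHm := hH.measurableSet
  have hi : ∀ u : Lp ℂ 2 (μ.restrict H), Integrable (H.indicator u) μ := fun u =>
    (integrable_indicator_iff hHm).2 ((Lp.memLp u).integrable one_le_two)
  have hind : ∀ {u v : G → ℂ}, u =ᵐ[μ.restrict H] v → H.indicator u =ᵐ[μ] H.indicator v :=
    fun h => (ae_restrict_iff' hHm).1 h |>.mono fun x hx => by
      by_cases hxH : x ∈ H
      · simp [hxH, hx hxH]
      · simp [hxH]
  have hmem : ∀ u : Lp ℂ 2 (μ.restrict H),
      MemLp (groupConv μ f (H.indicator u)) 2 (μ.restrict H) := fun u =>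
    MemLp.of_bound (hf.groupConv (hi u)).1.restrict _
      (.of_forall (norm_groupConv_le_of_bound_left hfM (hi u)))
  let T : Lp ℂ 2 (μ.restrict H) →ₗ[ℂ] Lp ℂ 2 (μ.restrict H) :=
    { toFun := fun u => (hmem u).toLp _
      map_add' := fun u v => by
        rw [← MemLp.toLp_add]
        refine MemLp.toLp_congr _ _ (ae_restrict_of_ae ?_)
        rw [groupConv_congr (ae_eq_refl f) (hind (Lp.coeFn_add u v)), Set.indicator_add']
        exact groupConv_add_right hf (hi u) (hi v)
      map_smul' := fun c u => by
        rw [RingHom.id_apply, ← MemLp.toLp_const_smul]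
        refine MemLp.toLp_congr _ _ (ae_restrict_of_ae (.of_forall fun x => ?_))
        rw [groupConv_congr (ae_eq_refl f) (hind (Lp.coeFn_smul c u)),
          show H.indicator (c • (u : G → ℂ)) = c • H.indicator u from
            Set.indicator_const_smul H c u, groupConv_smul_right] }
  have hT : ∀ u, T u =ᵐ[μ.restrict H] groupConv μ f (H.indicator u) := fun u =>
    (hmem u).coeFn_toLp
  refine ⟨T, fun u v => ?_, hT⟩
  have h1 : inner ℂ (T u) v = (starRingEnd ℂ)
      (∫ x, groupConv μ f (H.indicator u) x * (starRingEnd ℂ) (H.indicator v x) ∂μ) := by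
    rw [L2.inner_def, ← integral_conj, ← integral_indicator hHm]
    refine integral_congr_ae ?_
    filter_upwards [hind (hT u)] with x hx
    by_cases hxH : x ∈ H
    · simp only [Set.indicator_of_mem hxH] at hx ⊢
      simp [hx, RCLike.inner_apply, mul_comm]
    · simp [hxH]
  have h2 : inner ℂ u (T v) = (starRingEnd ℂ)
      (∫ x, H.indicator u x * (starRingEnd ℂ) (groupConv μ f (H.indicator v) x) ∂μ) := by
    rw [L2.inner_def, ← integral_conj, ← integral_indicator hHm]
    refine integral_congr_ae ?_
    filter_upwards [hind (hT v)] with x hx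
    by_cases hxH : x ∈ H
    · simp only [Set.indicator_of_mem hxH] at hx ⊢
      simp [hx, RCLike.inner_apply, mul_comm]
    · simp [hxH]
  rw [h1, h2, integral_groupConv_mul_conj hf hfM hstar (hi u) (hi v)]

/-- For `z` non-real and `f` bounded, self-adjoint and supported in a compact subgroup `H`, the
equation `f * g = z g - c f = g * f` has a bounded solution supported in `H`. -/
lemma exists_bounded_resolvent {H : Subgroup G} (hH : IsCompact (H : Set G)) (hf : Integrable f μ)
    {M : ℝ} (hfM : ∀ x, ‖f x‖ ≤ M) (hstar : groupStar f =ᵐ[μ] f) (hfH : ∀ x ∉ H, f x = 0)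
    {z : ℂ} (hz : z ∉ Set.range ((↑) : ℝ → ℂ)) (c : ℂ) :
    ∃ g : G → ℂ, AEStronglyMeasurable g μ ∧ (∃ B, ∀ x, ‖g x‖ ≤ B) ∧ (∀ x ∉ H, g x = 0) ∧
      groupConv μ f g =ᵐ[μ] z • g - c • f ∧ groupConv μ g f =ᵐ[μ] z • g - c • f := by
  have hz0 : z ≠ 0 := fun h => hz ⟨0, by simp [h]⟩
  have : IsFiniteMeasure (μ.restrict (H : Set G)) :=
    isFiniteMeasure_restrict.2 hH.measure_lt_top.ne
  have hHm := hH.measurableSet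
  obtain ⟨T, hTs, hT⟩ := exists_isSymmetric_groupConv hH hf hfM hstar
  set T' : Lp ℂ 2 (μ.restrict (H : Set G)) →L[ℂ] Lp ℂ 2 (μ.restrict (H : Set G)) :=
    -- A symmetric operator defined on the whole Hilbert space is bounded (Hellinger–Toeplitz), so
    -- it has real spectrum and `z - T` is invertible.
    hTs.toSelfAdjoint.1
  have hT' : ∀ u, T' u = T u := fun u => hTs.toSelfAdjoint_apply
  have hunit : IsUnit (algebraMap ℂ _ z - T') := by
    by_contra h
    exact hz ⟨z.re, (hTs.toSelfAdjoint.2.mem_spectrum_eq_re h).symm⟩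
  obtain ⟨S, hS1, hS2⟩ : ∃ S, (algebraMap ℂ _ z - T') * S = 1 ∧ S * (algebraMap ℂ _ z - T') = 1 := by
    obtain ⟨U, hU⟩ := hunit
    exact ⟨↑U⁻¹, hU ▸ U.mul_inv, hU ▸ U.inv_mul⟩
  have hfL : MemLp f 2 (μ.restrict (H : Set G)) :=
    MemLp.of_bound hf.1.restrict M (.of_forall hfM)
  have hind : ∀ {u v : G → ℂ}, u =ᵐ[μ.restrict (H : Set G)] v → (∀ x ∉ H, v x = 0) →
      (H : Set G).indicator u =ᵐ[μ] v := fun h hv =>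
    (ae_restrict_iff' hHm).1 h |>.mono fun x hx => by
      by_cases hxH : x ∈ H
      · simp [hxH, hx hxH]
      · simp [hxH, hv x hxH]
  set u := S (c • hfL.toLp f)
  have hu : z • u - T u = c • hfL.toLp f := by
    have := congrArg (fun R : Lp ℂ 2 (μ.restrict (H : Set G)) →L[ℂ] Lp ℂ 2 (μ.restrict (H : Set G)) => R (c • hfL.toLp f)) hS1
    simpa only [mul_apply_eq_comp, sub_apply, hT', Algebra.algebraMap_eq_smul_one, smul_apply,
      one_apply_eq_self] using this
  set g₀ := (H : Set G).indicator u with hg₀def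
  have hg₀ : Integrable g₀ μ :=
    (integrable_indicator_iff hHm).2 ((Lp.memLp u).integrable one_le_two)
  have hg₀H : ∀ x ∉ H, g₀ x = 0 := fun x hx => Set.indicator_of_notMem (by simpa using hx) _
  -- The equation `u = z⁻¹ (f * u + c f)` defines a better representative: its right side is bounded
  -- because `f` is bounded and `u` integrable, and it vanishes everywhere off `H`.
  set g := z⁻¹ • (groupConv μ f g₀ + c • f) with hg
  have hgH : ∀ x ∉ H, g x = 0 := fun x hx => by
    simp [hg, groupConv_eq_zero_of_notMem hfH hg₀H hx, hfH x hx]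
  have hgg₀ : g₀ =ᵐ[μ] g := by
    refine hind ?_ hgH
    have h1 : (z • u - T u : Lp ℂ 2 (μ.restrict (H : Set G))) =ᵐ[μ.restrict (H : Set G)]
        (c • hfL.toLp f : Lp ℂ 2 (μ.restrict (H : Set G))) := by rw [hu]
    filter_upwards [h1, Lp.coeFn_sub (z • u) (T u), Lp.coeFn_smul z u,
      Lp.coeFn_smul c (hfL.toLp f), hfL.coeFn_toLp, hT u] with x h1 h2 h3 h4 h5 h6
    simp only [Pi.sub_apply, Pi.smul_apply, smul_eq_mul] at h1 h2 h3 h4 h5 h6 ⊢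
    rw [h2, h3, h4, h5, h6] at h1
    rw [hg]
    simp only [Pi.smul_apply, Pi.add_apply, smul_eq_mul]
    rw [← h1]
    field_simp
    ring
  have hgi := hg₀.congr hgg₀
  have hgM : ∃ B, ∀ x, ‖g x‖ ≤ B := by
    refine ⟨‖z⁻¹‖ * ((ENNReal.ofReal M * ∫⁻ y, ‖g₀ y‖ₑ ∂μ).toReal + ‖c‖ * M), fun x => ?_⟩
    rw [hg, Pi.smul_apply, norm_smul, Pi.add_apply, Pi.smul_apply]
    refine mul_le_mul_of_nonneg_left ((norm_add_le _ _).trans (add_le_add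
      (norm_groupConv_le_of_bound_left hfM hg₀ x) ?_)) (norm_nonneg _)
    rw [norm_smul]
    exact mul_le_mul_of_nonneg_left (hfM x) (norm_nonneg _)
  have hfg : groupConv μ f g = z • g - c • f := by
    rw [← groupConv_congr (ae_eq_refl f) hgg₀, hg, smul_inv_smul₀ hz0, add_sub_cancel_right]
  clear_value g
  refine ⟨g, hgi.1, hgM, hgH, .of_forall fun x => by rw [hfg], ?_⟩
  -- Associativity and `f * g = z g - c f` give `f * d = z d` for the commutator `d`. As `z - T` is
  -- injective, `d` vanishes, so the right inverse is two-sided.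
  set d := groupConv μ f g - groupConv μ g f with hd
  have hfgi := hf.groupConv hgi
  have hgfi := hgi.groupConv hf
  have hdH : ∀ x ∉ H, d x = 0 := fun x hx => by
    simp [hd, groupConv_eq_zero_of_notMem hfH hgH hx, groupConv_eq_zero_of_notMem hgH hfH hx]
  have hdL : MemLp d 2 (μ.restrict (H : Set G)) :=
    (MemLp.of_bound hfgi.1.restrict _
      (.of_forall (norm_groupConv_le_of_bound_left hfM hgi))).sub
    (MemLp.of_bound hgfi.1.restrict _ (.of_forall (norm_groupConv_le_of_bound_right hfM hgi)))
  have hfd : groupConv μ f d =ᵐ[μ] z • d := by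
    have e1 := groupConv_sub_right hf hfgi hgfi
    have e2 := groupConv_assoc hf hgi hf
    have e3 := groupConv_sub_left (hgi.smul z) (hf.smul c) hf
    have e4 := groupConv_sub_right hf (hgi.smul z) (hf.smul c)
    rw [← hfg] at e3 e4
    rw [groupConv_smul_left, groupConv_smul_left] at e3
    rw [groupConv_smul_right, groupConv_smul_right] at e4
    filter_upwards [e1, e2, e3, e4] with x h1 h2 h3 h4
    simp only [hd, Pi.sub_apply, Pi.smul_apply, smul_eq_mul] at h1 h2 h3 h4 ⊢
    rw [h1, ← h2, h3, h4]
    ring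
  have hd0 : hdL.toLp d = 0 := by
    have hTd : z • hdL.toLp d - T (hdL.toLp d) = 0 := by
      rw [sub_eq_zero]
      ext1
      have h1 := hT (hdL.toLp d)
      rw [groupConv_congr (ae_eq_refl f) (hind hdL.coeFn_toLp hdH)] at h1
      filter_upwards [h1, ae_restrict_of_ae hfd, Lp.coeFn_smul z (hdL.toLp d), hdL.coeFn_toLp]
        with x h1 h2 h3 h4
      rw [h1, h2, h3, Pi.smul_apply, Pi.smul_apply, h4]
    have := congrArg (fun R : Lp ℂ 2 (μ.restrict (H : Set G)) →L[ℂ] Lp ℂ 2 (μ.restrict (H : Set G)) => R (hdL.toLp d)) hS2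
    simp only [mul_apply_eq_comp, sub_apply, hT', Algebra.algebraMap_eq_smul_one, smul_apply,
      one_apply_eq_self, hTd, map_zero] at this
    exact this.symm
  have hd0' : d =ᵐ[μ] 0 := by
    have h1 : d =ᵐ[μ.restrict (H : Set G)] 0 :=
      hdL.coeFn_toLp.symm.trans (hd0 ▸ Lp.coeFn_zero ℂ 2 (μ.restrict (H : Set G)))
    have h2 := hind h1.symm hdH
    simpa using h2.symm
  filter_upwards [hd0'] with x hx
  rw [← hfg]
  simp only [hd, Pi.sub_apply, Pi.zero_apply, sub_eq_zero] at hx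
  exact hx.symm

end Resolvent

/-! ### Real spectrum of self-adjoint elements of `C_c(G)` -/

section QuasiHermitian

variable {G : Type*} [Group G] [TopologicalSpace G] [IsTopologicalGroup G]
  [MeasurableSpace G] [BorelSpace G] [T2Space G] {μ : Measure G} {Φ Ψ : ℝ → ℝ≥0∞} {ω : G → ℝ}
  [μ.IsMulRightInvariant] [μ.IsInvInvariant] [LocallyCompactSpace G] [NormalSpace G]
  [μ.IsHaarMeasure] [μ.Regular]

lemma IsLPhiWeight.isQuasiHermitianAlgebra (hG : IsLocallyElliptic G)
    (hω : IsLPhiWeight Φ Ψ ω μ) (hΦΨ : IsComplementaryPair Φ Ψ)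
    (hinv : MemOrlicz Ψ μ (fun x => 1 / ω x)) :
    IsQuasiHermitianAlgebra μ (weightedOrliczSpace Φ Ψ ω μ) := by
  intro f hf hfc hfs hstar z hzspec
  by_contra hz
  refine hzspec ?_
  have hωm := hω.weight.measurable
  have hΦ := hΦΨ.left
  have hint : ∀ {f}, f ∈ weightedOrliczSpace Φ Ψ ω μ → Integrable f μ := fun hf =>
    weightedOrliczSpace_subset_integrable hΦΨ.right hω.weight.one_le hinv hf
  obtain ⟨H, -, hHc, hfH⟩ := hG.exists_isCompact_isOpen_subgroup hfs.isCompact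
  obtain ⟨M, hM⟩ := hfs.exists_bound_of_continuous hfc
  have hz0 : z ≠ 0 := fun h => hz ⟨0, by simp [h]⟩
  -- With `c = -z⁻¹` the resolvent equation reads `f * g - z g - z⁻¹ f = 0`, which is `(f - z)(-z⁻¹
  -- + g) = 1`; the equation for `g * f` gives the other order.
  obtain ⟨g, hgm, ⟨B, hB⟩, hgH, hfg, hgf⟩ := exists_bounded_resolvent hHc (hint hf) hM hstar
    (fun x hx => image_eq_zero_of_notMem_tsupport fun h => hx (hfH h)) hz (-z⁻¹)
  have hgA : g ∈ weightedOrliczSpace Φ Ψ ω μ := hω.weight.mem_weightedOrliczSpace hΦΨ hHc hgm hB hgH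
  have hfi := hint hf
  have hgi := hint hgA
  by_cases he : ∃ e, IsConvIdentity μ (weightedOrliczSpace Φ Ψ ω μ) e
  · left
    obtain ⟨e, he⟩ := he
    have hei := hint he.1
    have hcei : Integrable ((-z⁻¹) • e) μ := hei.smul _
    have hzei : Integrable (z • e) μ := hei.smul _
    refine ⟨e, he, (-z⁻¹) • e + g, weightedOrliczSpace_add hΦ hωm
      (weightedOrliczSpace_const_smul hΦ _ he.1) hgA, ?_, ?_⟩
    · have e1 := groupConv_sub_left hfi hzei (hcei.add hgi)
      have e2 := groupConv_add_right hfi hcei hgi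
      have e3 := groupConv_add_right hei hcei hgi
      rw [groupConv_smul_left] at e1
      rw [groupConv_smul_right] at e2 e3
      filter_upwards [e1, e2, e3, (he.2 f hf).2, (he.2 g hgA).1, (he.2 e he.1).1, hfg]
        with x h1 h2 h3 h4 h5 h6 h7
      simp only [Pi.add_apply, Pi.sub_apply, Pi.smul_apply, smul_eq_mul] at h1 h2 h3 h7 ⊢
      rw [h1, h2, h3, h4, h5, h6, h7]
      field_simp
      ring
    · have e1 := groupConv_sub_right (hcei.add hgi) hfi hzei
      have e2 := groupConv_add_left hcei hgi hfi
      have e3 := groupConv_add_left hcei hgi hei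
      rw [groupConv_smul_right] at e1
      rw [groupConv_smul_left] at e2 e3
      filter_upwards [e1, e2, e3, (he.2 f hf).1, (he.2 g hgA).2, (he.2 e he.1).1, hgf]
        with x h1 h2 h3 h4 h5 h6 h7
      simp only [Pi.add_apply, Pi.sub_apply, Pi.smul_apply, smul_eq_mul] at h1 h2 h3 h7 ⊢
      rw [h1, h2, h3, h4, h5, h6, h7]
      field_simp
      ring
  · right
    refine ⟨he, -z⁻¹, g, hgA, ⟨by simp [unitizationMul, hz0], ?_⟩,
      ⟨by simp [unitizationMul, hz0], ?_⟩⟩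
    · filter_upwards [hfg] with x hx
      simp only [unitizationMul, Pi.add_apply, Pi.sub_apply, Pi.smul_apply, smul_eq_mul,
        Pi.zero_apply] at hx ⊢
      rw [hx]
      ring
    · filter_upwards [hgf] with x hx
      simp only [unitizationMul, Pi.add_apply, Pi.sub_apply, Pi.smul_apply, smul_eq_mul,
        Pi.zero_apply] at hx ⊢
      rw [hx]
      ring

end QuasiHermitian

/-! ### The theorem -/

theorem theorem2 {G : Type*} [Group G] [TopologicalSpace G] [IsTopologicalGroup G]
    [LocallyCompactSpace G] [T2Space G] [MeasurableSpace G] [BorelSpace G]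
    (μ : Measure G) [μ.IsHaarMeasure] [μ.Regular]
    (hG : IsLocallyElliptic G)
    (Φ Ψ : ℝ → ℝ≥0∞) (hΦΨ : IsComplementaryPair Φ Ψ)
    (ω : G → ℝ) (hω : IsLPhiWeight Φ Ψ ω μ)
    (hω_inv : MemOrlicz Ψ μ (fun x => 1 / ω x)) :
    ((∀ f : G → ℂ, Continuous f → HasCompactSupport f → f ∈ weightedOrliczSpace Φ Ψ ω μ) ∧
      IsQuasiHermitianAlgebra μ (weightedOrliczSpace Φ Ψ ω μ)) ∧
    (IsHermitianGroup μ → IsSubadditiveWeight ω →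
      weightedOrliczSpace Φ Ψ ω μ ⊆ integrableFunctions μ ∧
      (∀ f ∈ weightedOrliczSpace Φ Ψ ω μ,
        convSpectrum μ (weightedOrliczSpace Φ Ψ ω μ) f =
          convSpectrum μ (integrableFunctions μ) f) ∧
      IsHermitianAlgebra μ (weightedOrliczSpace Φ Ψ ω μ)) := by
  have hri := hG.isMulRightInvariant μ
  have hii := hG.isInvInvariant μ
  have hn := hG.normalSpace
  refine ⟨⟨fun f hf hfs => hω.weight.continuous_mem_weightedOrliczSpace hΦΨ hf hfs,
    hω.isQuasiHermitianAlgebra hG hΦΨ hω_inv⟩, fun hH hsub => ?_⟩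
  have hsub1 : weightedOrliczSpace Φ Ψ ω μ ⊆ integrableFunctions μ := fun f hf =>
    weightedOrliczSpace_subset_integrable hΦΨ.right hω.weight.one_le hω_inv hf
  have hspec := fun f hf => hω.convSpectrum_eq hΦΨ hω_inv hsub (f := f) hf
  exact ⟨hsub1, hspec, fun f hf hstar => (hspec f hf).symm ▸ hH f (hsub1 hf) hstar⟩
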